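/- Let $d\ge 0$ be an integer and $[d+1]=\{1,\dots,d+1\}$. **Ordered set partitions.** Let $\mathcal O_{d+1}$ be the set of ordered set partitions $\mathcal T=(S_1,\dots,S_k)=S_1|\cdots|S_k$ of $[d+1]$ into nonempty blocks, ordered by refinement: $\mathcal T\le \mathcal T'$ if $\mathcal T'$ arises from $\mathcal T$ by merging consecutive blocks. Its maximum is $[d+1]$ (one block), and $S_1|\cdots|S_k$ has rank $d+1-k$. For $\pi\in\mathfrak S_{d+1}$ let $\mathcal T(\pi)=\pi^{-1}(1)|\cdots|\pi^{-1}(d+1)$; the interval $[\mathcal T(\pi),[d+1]]$ is a Boolean algebra. Put $\mathbf e_{\mathcal T}=\sum_{i} i\,\mathbf e_{S_i}\in\mathbb R^{d+1}$, where $\mathbf e_S=\sum_{j\in S}\mathbf e_j$; in particular $\mathbf e_{[d+1]}=\mathbf 1$. **Nested Braid fan.** Let $V_d=\{\mathbf x\in\mathbb R^{d+1}:\langle \mathbf 1,\mathbf x\rangle=0\}$ and $W_d=\mathbb R^{d+1}/\mathbb R\mathbf 1$, its dual space. For $(\pi,\tau)\in\mathfrak S_{d+1}\times\mathfrak S_d$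 let $\sigma(\pi,\tau)\subset W_d$ be the cone of all $\mathbf x$ with $x_{\pi^{-1}(1)}\le\cdots\le x_{\pi^{-1}(d+1)}$ and $(\Delta\mathbf x)^\pi_{\tau^{-1}(1)}\le\cdots\le(\Delta\mathbf x)^\pi_{\tau^{-1}(d)}$, where $(\Delta\mathbf x)^\pi_i=x_{\pi^{-1}(i+1)}-x_{\pi^{-1}(i)}$. The nested Braid fan $\mathrm{Br}_d^2$ consists of the cones $\sigma(\pi,\tau)$ and all their faces. A *generalized nested permutohedron* is a nonempty polytope $P$ in a translate of $V_d$ whose normal fan is a coarsening of $\mathrm{Br}_d^2$; that is, for every nonempty face $F$ of $P$ the normal cone $\{\mathbf w\in W_d:\langle\mathbf w,\mathbf x\rangle\ge\langle\mathbf w,\mathbf y\rangle\ \ \forall\,\mathbf x\in F,\ \mathbf y\in P\}$ is a union of cones of $\mathrm{Br}_d^2$. **Conditions on** $\mathbf b\in\mathbb R^{\mathcal O_{d+1}}$. 1. (Local submodularity) For every $\pi\in\mathfrak S_{d+1}$ and all $\mathcal S,\mathcal T\in[\mathcal T(\pi),[d+1]]$, $$b_{\mathcal S\vee\mathcal T}+b_{\mathcal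 S\wedge\mathcal T}\le b_{\mathcal S}+b_{\mathcal T}.$$ 2. (Ren condition) For every rank-$1$ element $\mathcal T=s_1|\cdots|s_{i-1}|s_is_i'|s_{i+1}|\cdots|s_d$ of $\mathcal O_{d+1}$, let $\mathcal T_0,\mathcal T_0'$ be the two rank-$0$ elements below $\mathcal T$ and let $\mathcal S=s_1\cdots s_{i-1}|s_is_i'|s_{i+1}\cdots s_d$ (with empty blocks omitted) be the maximum element above $\mathcal T$ that still has $\{s_i,s_i'\}$ as a block. Then $$2b_{\mathcal T}+b_{\mathcal S}\le b_{\mathcal T_0}+b_{\mathcal T_0'}+\epsilon_i\, b_{[d+1]},\qquad \epsilon_i=0\text{ if } i=1,\quad \epsilon_i=1\text{ if } i\ne 1.$$ **Theorem.** For $\mathbf b\in\mathbb R^{\mathcal O_{d+1}}$ consider the linear system $$\langle\mathbf 1,\mathbf x\rangle=b_{[d+1]},\qquad \langle\mathbf e_{\mathcal T},\mathbf x\rangle\le b_{\mathcal T}\quad\text{for all }\mathcal T\in\mathcal O_{d+1}\setminus\{[d+1]\}.\tag{$*$}$$ (a) If $\mathbf b$ satisfies local submodularity and the ren condition, then the solution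 set of $(*)$ is a generalized nested permutohedron. (b) For every generalized nested permutohedron $P\subset\mathbb R^{d+1}$ there is exactly one $\mathbf b$ satisfying local submodularity and the ren condition such that $P$ is the solution set of $(*)$. (c) Suppose a polytope $P\subset\mathbb R^{d+1}$ is the solution set of $(*)$ and the representation is tight, i.e. each inequality in $(*)$ holds with equality at some point of $P$. Then $P$ is a generalized nested permutohedron if and only if $\mathbf b$ satisfies local submodularity and the ren condition. -/

import Mathlib

namespace NestedBraid

/-! ### Polytopes, faces, normal fans -/

/-- A polyhedron in `ℝⁿ`: the solution set of finitely many linear inequalities. -/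
def IsPolyhedron {n : ℕ} (P : Set (Fin n → ℝ)) : Prop :=
  ∃ (m : ℕ) (a : Fin m → Fin n → ℝ) (c : Fin m → ℝ), P = {x | ∀ i, a i ⬝ᵥ x ≤ c i}

/-- A polytope: a bounded polyhedron. -/
def IsPolytope {n : ℕ} (P : Set (Fin n → ℝ)) : Prop :=
  IsPolyhedron P ∧ Bornology.IsBounded P

/-- `F` is a (nonempty) face of the convex set `C`: the set of points of `C` at which some linear
functional attains its maximum over `C`. The zero functional gives the face `C` itself. -/
def IsFace {E : Type*} [AddCommGroup E] [Module ℝ E] (C F : Set E) : Prop :=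
  F.Nonempty ∧ ∃ φ : E →ₗ[ℝ] ℝ, F = {x | x ∈ C ∧ ∀ y ∈ C, φ y ≤ φ x}

/-- The space `W_d = ℝ^{d+1} / ℝ𝟏`, the dual of `V_d = {x : ⟨𝟏, x⟩ = 0}`. -/
abbrev W (d : ℕ) : Type := (Fin (d + 1) → ℝ) ⧸ Submodule.span ℝ {(1 : Fin (d + 1) → ℝ)}

/-- The class in `W_d` of a vector of `ℝ^{d+1}`. -/
def toW (d : ℕ) : (Fin (d + 1) → ℝ) →ₗ[ℝ] W d := Submodule.mkQ _

/-- The normal cone of `P` at `F`: the `w ∈ W_d` with `⟨w, x⟩ ≥ ⟨w, y⟩` for all `x ∈ F`, `y ∈ P`.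
It is used for `P` inside a translate of `V_d`, where `⟨w, x⟩ - ⟨w, y⟩ = ⟨w, x - y⟩` does not
depend on the vector `u` that represents `w`. -/
def ncone {d : ℕ} (F P : Set (Fin (d + 1) → ℝ)) : Set (W d) :=
  {w | ∃ u : Fin (d + 1) → ℝ, toW d u = w ∧ ∀ x ∈ F, ∀ y ∈ P, u ⬝ᵥ y ≤ u ⬝ᵥ x}

/-- The normal fan of `P`: all normal cones of `P` at its (nonempty) faces. -/
def normalFan {d : ℕ} (P : Set (Fin (d + 1) → ℝ)) : Set (Set (W d)) :=
  {C | ∃ F, IsFace P F ∧ C = ncone F P}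

/-- The fan `Σ'` is a coarsening of `Σ`: every cone of `Σ'` is a union of cones of `Σ`. -/
def IsCoarsening {E : Type*} (Sig' Sig : Set (Set E)) : Prop :=
  ∀ C ∈ Sig', ∃ A ⊆ Sig, C = ⋃₀ A

/-! ### The nested Braid fan and generalized nested permutohedra -/

/-- The first differences `(Δx)^π_i = x_{π⁻¹(i+1)} - x_{π⁻¹(i)}`. -/
def firstDiff {d : ℕ} (π : Equiv.Perm (Fin (d + 1))) (x : Fin (d + 1) → ℝ) (i : Fin d) : ℝ :=
  x (π.symm i.succ) - x (π.symm i.castSucc)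

/-- The closed cone `σ(π, τ)` in `W_d`: the classes of the vectors `x` with
`x_{π⁻¹(1)} ≤ ⋯ ≤ x_{π⁻¹(d+1)}` and `(Δx)^π_{τ⁻¹(1)} ≤ ⋯ ≤ (Δx)^π_{τ⁻¹(d)}`. -/
def nestedCone {d : ℕ} (π : Equiv.Perm (Fin (d + 1))) (τ : Equiv.Perm (Fin d)) : Set (W d) :=
  {w | ∃ x : Fin (d + 1) → ℝ, toW d x = w ∧
    Monotone (fun i => x (π.symm i)) ∧ Monotone (fun i => firstDiff π x (τ.symm i))}

/-- The nested Braid fan: the cones `σ(π, τ)` together with all of their faces. -/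
def nestedBraidFan (d : ℕ) : Set (Set (W d)) :=
  {F | ∃ (π : Equiv.Perm (Fin (d + 1))) (τ : Equiv.Perm (Fin d)), IsFace (nestedCone π τ) F}

/-- A generalized nested permutohedron in `ℝ^{d+1}`: a (nonempty) polytope in a translate of `V_d`
whose normal fan is a coarsening of the nested Braid fan. -/
def IsGeneralizedNestedPermutohedron {d : ℕ} (P : Set (Fin (d + 1) → ℝ)) : Prop :=
  P.Nonempty ∧ IsPolytope P ∧ (∃ N : ℝ, ∀ x ∈ P, 1 ⬝ᵥ x = N) ∧
    IsCoarsening (normalFan P) (nestedBraidFan d)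

/-! ### Ordered set partitions -/

/-- An ordered set partition `S₁ | S₂ | ⋯ | S_k` of a set with `d + 1` elements; the block called
`S_{i+1}` in mathematical notation is `block i`. -/
structure OrderedPartition (d : ℕ) where
  k : ℕ
  block : Fin k → Finset (Fin (d + 1))
  block_nonempty : ∀ i, (block i).Nonempty
  block_disjoint : ∀ i j, i ≠ j → Disjoint (block i) (block j)
  block_cover : ∀ x, ∃ i, x ∈ block i

namespace OrderedPartition

variable {d : ℕ}

/-- Refinement: `T ≤ U` when every block of `T` lies in a block of `U`, compatibly with the order
of the blocks, i.e. `U` arises from `T` by merging consecutive blocks. -/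
instance : LE (OrderedPartition d) where
  le T U := ∃ f : Fin T.k → Fin U.k, Monotone f ∧ ∀ i, T.block i ⊆ U.block (f i)

theorem eq_of_block_subset (T : OrderedPartition d) {i j : Fin T.k}
    (h : T.block i ⊆ T.block j) : i = j := by
  by_contra hne
  obtain ⟨x, hx⟩ := T.block_nonempty i
  exact Finset.disjoint_left.mp (T.block_disjoint i j hne) hx (h hx)

theorem le_antisymm' (T U : OrderedPartition d) (h₁ : T ≤ U) (h₂ : U ≤ T) : T = U := by
  obtain ⟨f, hf, hfs⟩ := h₁
  obtain ⟨g, hg, hgs⟩ := h₂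
  have hgf : ∀ i, g (f i) = i := fun i =>
    (T.eq_of_block_subset ((hfs i).trans (hgs (f i)))).symm
  have hfg : ∀ i, f (g i) = i := fun i =>
    (U.eq_of_block_subset ((hgs i).trans (hfs (g i)))).symm
  let e : Fin T.k ≃o Fin U.k :=
    { toFun := f, invFun := g, left_inv := hgf, right_inv := hfg
      map_rel_iff' := by
        intro a b
        constructor
        · intro h
          have h' := hg h
          simpa [hgf] using h'
        · intro h
          exact hf h }
  have hk : T.k = U.k := by simpa using Fintype.card_congr e.toEquiv
  obtain ⟨k, B, h1, h2, h3⟩ := T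
  obtain ⟨k', B', h1', h2', h3'⟩ := U
  dsimp only at hk
  subst hk
  have he : e = OrderIso.refl _ := Subsingleton.elim _ _
  have hfid : ∀ i, f i = i := fun i => by
    have := congrArg (fun e' : Fin k ≃o Fin k => e' i) he
    simpa [e] using this
  have hB : B = B' := by
    funext i
    apply Finset.Subset.antisymm
    · have h := hfs i
      rwa [hfid i] at h
    · have h := hgs (f i)
      rwa [hgf i, hfid i] at h
  subst hB
  rfl

/-- The poset `𝒪_{d+1}` of ordered set partitions, ordered by refinement. -/
instance : PartialOrder (OrderedPartition d) where
  le_refl T := ⟨id, monotone_id, fun _ => Finset.Subset.refl _⟩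
  le_trans _ _ _ := by
    rintro ⟨f, hf, hfs⟩ ⟨g, hg, hgs⟩
    exact ⟨g ∘ f, hg.comp hf, fun i => (hfs i).trans (hgs (f i))⟩
  le_antisymm := le_antisymm'

/-- The maximum of `𝒪_{d+1}` is the partition `([d+1])` with a single block. -/
instance : OrderTop (OrderedPartition d) where
  top :=
    { k := 1
      block := fun _ => Finset.univ
      block_nonempty := fun _ => Finset.univ_nonempty
      block_disjoint := fun i j h => absurd (Subsingleton.elim i j) h
      block_cover := fun x => ⟨0, Finset.mem_univ x⟩ }
  le_top _ := ⟨fun _ => 0, fun _ _ _ => le_rfl, fun _ => Finset.subset_univ _⟩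

/-- The partition `𝒯(π) = ({π⁻¹(1)}, …, {π⁻¹(d+1)})` into singletons. -/
def ofPerm (π : Equiv.Perm (Fin (d + 1))) : OrderedPartition d where
  k := d + 1
  block i := {π.symm i}
  block_nonempty i := Finset.singleton_nonempty _
  block_disjoint i j h := by simpa using h
  block_cover x := ⟨π x, by simp⟩

/-- The rank of `T` in `𝒪_{d+1}`; there are at most `d + 1` blocks. -/
def rank (T : OrderedPartition d) : ℕ := d + 1 - T.k

/-- The vector `e_T = ∑ i • e_{S_i}`, where `e_S` is the indicator vector of `S`. -/
noncomputable def e (T : OrderedPartition d) : Fin (d + 1) → ℝ :=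
  ∑ i : Fin T.k, ((i : ℝ) + 1) • Set.indicator (T.block i : Set (Fin (d + 1))) 1

end OrderedPartition

/-! ### The linear system and the two conditions -/

/-- The solution set of `⟨𝟏, x⟩ = b_{[d+1]}` and `⟨e_T, x⟩ ≤ b_T` for all `T ≠ [d+1]`. -/
def solutionSet {d : ℕ} (b : OrderedPartition d → ℝ) : Set (Fin (d + 1) → ℝ) :=
  {x | 1 ⬝ᵥ x = b ⊤ ∧ ∀ T, T ≠ ⊤ → T.e ⬝ᵥ x ≤ b T}

/-- The system given by `b` is a tight representation of its solution set: each of its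
inequalities holds with equality at some solution. -/
def IsTight {d : ℕ} (b : OrderedPartition d → ℝ) : Prop :=
  ∀ T, T ≠ ⊤ → ∃ x ∈ solutionSet b, T.e ⬝ᵥ x = b T

/-- Local submodularity: `b_{S ∨ T} + b_{S ∧ T} ≤ b_S + b_T` for all `S`, `T` in a maximal interval
`[𝒯(π), [d+1]]`. The join `J` and the meet `M` are taken in this interval, a Boolean algebra. -/
def LocallySubmodular {d : ℕ} (b : OrderedPartition d → ℝ) : Prop :=
  ∀ (π : Equiv.Perm (Fin (d + 1)))
    (S T J M : Set.Icc (OrderedPartition.ofPerm π) (⊤ : OrderedPartition d)),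
    IsLUB {S, T} J → IsGLB {S, T} M → b J + b M ≤ b S + b T

/-- The essential inequality of an element `T = s₁ | ⋯ | s_i s_i' | ⋯ | s_d` of rank one. Here
`T₀`, `T₀'` are the two elements of rank zero below `T`, and `S` is the maximum of the elements
above `T` in which `{s_i, s_i'}` is still a block. The term `b_{[d+1]}` is absent when
`{s_i, s_i'}` is the first block of `T`. -/
def EssentialInequality {d : ℕ} (b : OrderedPartition d → ℝ) (T : OrderedPartition d) : Prop :=
  ∀ (i : Fin T.k) (T₀ T₀' S : OrderedPartition d),
    (T.block i).card = 2 →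
    T₀.rank = 0 → T₀'.rank = 0 → T₀ ≠ T₀' → T₀ ≤ T → T₀' ≤ T →
    IsGreatest {U | T ≤ U ∧ ∃ j, U.block j = T.block i} S →
    2 * b T + b S ≤ b T₀ + b T₀' + (if (i : ℕ) = 0 then 0 else b ⊤)

/-- The ren condition: the essential inequality of every element of rank one holds. -/
def RenCondition {d : ℕ} (b : OrderedPartition d → ℝ) : Prop :=
  ∀ T : OrderedPartition d, T.rank = 1 → EssentialInequality b T

end NestedBraid

/-!
An ordered set partition above `ofPerm π` is given by a set `A ⊆ Fin d` of separators between the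
positions `0, …, d` (`part π A`), merging blocks means removing separators, and
`e_T = 𝟏 + ∑_{j ∈ A} step π j`. Every vector is
`u = u(π⁻¹(0)) 𝟏 + ∑_j (Δu)^π_j • step π j`. Hence the generators of the cone `σ(π, τ)` modulo `𝟏`
are the vectors `e_T` where `T` has the separators with `τ`-value at least `k`, and a numbering `b`
of the ordered partitions is the same as a function on `ℝ^{d+1}` that is linear on all `σ(π, τ)`.
The theorem says that this function is convex, i.e. a support function, if and only if it is locally
convex: local submodularity is convexity across the walls inside a braid cone, and the ren condition
is convexity across the walls between adjacent braid cones.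

*From local to global.* For every `(π, τ)` let `v` be the point with `⟨e_T, v⟩ = b_T` at all
generators of `σ(π, τ)` (`IsVertexAt`). It has to satisfy `⟨u, v⟩ ≤ b_T` for every `u = e_T`. By the
greedy algorithm (`IsVertexAt.dotProduct_le`) submodularity gives this for the `T` that belong to
`π`; it also shows that, for fixed `π` and any `u`, the best `τ` is the one that sorts the first
differences of `u`. If `u` is not in the braid cone of `π`, then the smallest first difference is
negative, and the wall where it vanishes is a facet of `σ(π, τ)` for this `τ`. Crossing it
does not decrease `⟨u, v⟩`, by the ren condition combined with the greedy inequality for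
`neighbors i` (`IsVertexAt.dotProduct_le_swapAt`). The walk ends in a cone containing `u`, because
the potential `∑ π(x) u(x)` increases (`IsVertexAt.exists_sorted_dotProduct_le`). So all these
points are solutions (`IsVertexAt.mem_solutionSet`), and the support function of the solution set is
linear on all cones.

*Support functions and normal fans.* For a polytope in a translate of `V_d`, linearity of the
support function on the cones (`SupportLinear`) is equivalent to the normal fan being a coarsening
of the nested Braid fan. In one direction one takes, for a point of a normal cone, the minimal face
of `σ(π, τ)` through this point; in the other direction a generic point of `σ(π, τ)`.

*Necessity and uniqueness.* If the support function is linear on the cones, then the maxima `b_T` of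
`e_T` over the polytope are attained at a common point for comparable `T`. The two conditions follow
from the linear relations `e_part_inter_add_union` and `e_ofPerm_add_e_ofPerm_swapAt`, and `b` is
determined by the polytope because each `b_T` is such a maximum.
-/

namespace NestedBraid

open Finset

/-! ### Ordered partitions and sets of separators -/

namespace OrderedPartition

variable {d : ℕ}

theorem existsUnique_mem_block (T : OrderedPartition d) (x : Fin (d + 1)) :
    ∃! i, x ∈ T.block i := by
  obtain ⟨i, hi⟩ := T.block_cover x
  refine ⟨i, hi, fun j hj => ?_⟩
  by_contra hne
  exact Finset.disjoint_left.mp (T.block_disjoint j i hne) hj hi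

/-- The index of the block of `T` that contains `x`. -/
noncomputable def idx (T : OrderedPartition d) (x : Fin (d + 1)) : Fin T.k :=
  (T.block_cover x).choose

theorem mem_block_idx (T : OrderedPartition d) (x : Fin (d + 1)) : x ∈ T.block (T.idx x) :=
  (T.block_cover x).choose_spec

theorem mem_block_iff {T : OrderedPartition d} {x : Fin (d + 1)} {i : Fin T.k} :
    x ∈ T.block i ↔ T.idx x = i :=
  ⟨fun h => (T.existsUnique_mem_block x).unique (T.mem_block_idx x) h,
    fun h => h ▸ T.mem_block_idx x⟩

/-- The index of the block of `T` that contains `x`, as a natural number, counted from zero. -/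
noncomputable def lvl (T : OrderedPartition d) (x : Fin (d + 1)) : ℕ := T.idx x

theorem e_apply (T : OrderedPartition d) (x : Fin (d + 1)) : T.e x = T.lvl x + 1 := by
  classical
  rw [e, Finset.sum_apply, Finset.sum_eq_single (T.idx x)]
  · simp [T.mem_block_idx x, lvl]
  · intro i _ hi
    have : x ∉ T.block i := fun h => hi (mem_block_iff.mp h).symm
    simp [this]
  · simp

theorem le_iff {T U : OrderedPartition d} :
    T ≤ U ↔ ∀ x y, T.lvl x ≤ T.lvl y → U.lvl x ≤ U.lvl y := by
  constructor
  · rintro ⟨f, hf, hs⟩ x y hxy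
    have key : ∀ z, U.idx z = f (T.idx z) := fun z => mem_block_iff.mp (hs _ (T.mem_block_idx z))
    simp only [lvl, key]
    exact hf hxy
  · intro h
    choose r hr using T.block_nonempty
    have hr' : ∀ i, T.idx (r i) = i := fun i => mem_block_iff.mp (hr i)
    refine ⟨fun i => U.idx (r i), fun i j hij => h _ _ ?_, fun i x hx => ?_⟩
    · simpa [lvl, hr'] using hij
    · have hx' := mem_block_iff.mp hx
      have hl : T.lvl x = T.lvl (r i) := by simp [lvl, hx', hr']
      exact mem_block_iff.mpr (Fin.ext (le_antisymm (h _ _ hl.le) (h _ _ hl.ge)))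

theorem eq_of_lvl_le_iff {T U : OrderedPartition d}
    (h : ∀ x y, T.lvl x ≤ T.lvl y ↔ U.lvl x ≤ U.lvl y) : T = U :=
  le_antisymm (le_iff.mpr fun x y => (h x y).mp) (le_iff.mpr fun x y => (h x y).mpr)

@[simp]
theorem lvl_ofPerm (π : Equiv.Perm (Fin (d + 1))) (x : Fin (d + 1)) :
    (ofPerm π).lvl x = π x := by
  have : (ofPerm π).idx x = π x := mem_block_iff.mp (by simp [ofPerm])
  rw [lvl, this]

@[simp]
theorem lvl_top (x : Fin (d + 1)) : (⊤ : OrderedPartition d).lvl x = 0 :=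
  Nat.lt_one_iff.mp ((⊤ : OrderedPartition d).idx x).isLt

/-- The number of separators of `A` that lie before position `p`. The separator `j` stands
between the positions `j.castSucc` and `j.succ`. -/
def sepCount (A : Finset (Fin d)) (p : Fin (d + 1)) : ℕ := #{j ∈ A | j.castSucc < p}

theorem sepCount_mono (A : Finset (Fin d)) : Monotone (sepCount A) := fun p q h =>
  Finset.card_le_card fun j hj => by
    simp only [mem_filter] at hj ⊢
    exact ⟨hj.1, hj.2.trans_le h⟩

theorem sepCount_lt_iff {A : Finset (Fin d)} {p q : Fin (d + 1)} :
    sepCount A p < sepCount A q ↔ ∃ j ∈ A, p ≤ j.castSucc ∧ j.castSucc < q := by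
  constructor
  · intro h
    by_contra! hn
    refine absurd h (not_lt.mpr (Finset.card_le_card fun j hj => ?_))
    simp only [mem_filter] at hj ⊢
    refine ⟨hj.1, not_le.mp fun hp => ?_⟩
    exact absurd hj.2 (not_lt.mpr (hn j hj.1 hp))
  · rintro ⟨j, hj, hp, hq⟩
    refine Finset.card_lt_card ⟨fun l hl => ?_, fun hs => ?_⟩
    · simp only [mem_filter] at hl ⊢
      exact ⟨hl.1, hl.2.trans (hp.trans_lt hq)⟩
    · have := hs (mem_filter.mpr ⟨hj, hq⟩)
      simp only [mem_filter] at this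
      exact absurd this.2 (not_lt.mpr hp)

theorem sepCount_le_iff {A : Finset (Fin d)} {p q : Fin (d + 1)} :
    sepCount A p ≤ sepCount A q ↔ ∀ j ∈ A, q ≤ j.castSucc → p ≤ j.castSucc := by
  rw [← not_lt, sepCount_lt_iff]
  push Not
  rfl

theorem sepCount_zero (A : Finset (Fin d)) : sepCount A 0 = 0 := by
  simp [sepCount]

theorem sepCount_last (A : Finset (Fin d)) : sepCount A (Fin.last d) = #A := by
  simp [sepCount, Fin.castSucc_lt_last]

theorem sepCount_succ (A : Finset (Fin d)) (j : Fin d) :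
    sepCount A j.succ = sepCount A j.castSucc + if j ∈ A then 1 else 0 := by
  have : {l ∈ A | l.castSucc < j.succ} =
      {l ∈ A | l.castSucc < j.castSucc} ∪ {l ∈ A | l = j} := by
    ext l
    simp only [mem_filter, mem_union, Fin.lt_def, Fin.ext_iff, Fin.val_castSucc, Fin.val_succ]
    grind
  rw [sepCount, this, Finset.card_union_of_disjoint, sepCount]
  · congr 1
    rw [Finset.filter_eq']
    split_ifs <;> simp
  · rw [Finset.disjoint_left]
    intro l h1 h2
    simp only [mem_filter] at h1 h2
    exact absurd h1.2 (by rw [h2.2]; exact lt_irrefl _)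

theorem exists_sepCount_eq (A : Finset (Fin d)) (p : Fin (d + 1)) :
    ∀ i ≤ sepCount A p, ∃ q, sepCount A q = i := by
  induction p using Fin.induction with
  | zero =>
    intro i hi
    rw [sepCount_zero] at hi
    exact ⟨0, by rw [sepCount_zero]; omega⟩
  | succ j ih =>
    intro i hi
    rcases Nat.lt_or_ge (sepCount A j.castSucc) i with h | h
    · refine ⟨j.succ, ?_⟩
      rw [sepCount_succ] at hi ⊢
      split_ifs at hi ⊢ <;> omega
    · exact ih i h

/-- The ordered partition above `ofPerm π` whose blocks are separated exactly at `A`: the element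
`x` stands at position `π x`, and the positions are cut into intervals at the separators `A`. -/
def part (π : Equiv.Perm (Fin (d + 1))) (A : Finset (Fin d)) : OrderedPartition d where
  k := #A + 1
  block i := {x | sepCount A (π x) = i}
  block_nonempty i := by
    obtain ⟨q, hq⟩ := exists_sepCount_eq A (Fin.last d) i
      (by rw [sepCount_last]; exact Nat.lt_succ_iff.mp i.isLt)
    exact ⟨π.symm q, by simp [hq]⟩
  block_disjoint i j h := by
    rw [Finset.disjoint_left]
    intro x hx hx'
    simp only [mem_filter, mem_univ, true_and] at hx hx'
    exact h (Fin.ext (hx.symm.trans hx'))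
  block_cover x := ⟨⟨sepCount A (π x), Nat.lt_succ_iff.mpr
    ((sepCount_mono A (Fin.le_last _)).trans (sepCount_last A).le)⟩, by simp⟩

@[simp]
theorem lvl_part (π : Equiv.Perm (Fin (d + 1))) (A : Finset (Fin d)) (x : Fin (d + 1)) :
    (part π A).lvl x = sepCount A (π x) := by
  have h := (part π A).mem_block_idx x
  simp only [part, mem_filter, mem_univ, true_and] at h
  exact h.symm

theorem part_le_part_iff {π : Equiv.Perm (Fin (d + 1))} {A B : Finset (Fin d)} :
    part π A ≤ part π B ↔ B ⊆ A := by
  rw [le_iff]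
  simp only [lvl_part, sepCount_le_iff]
  constructor
  · intro h j hj
    by_contra hA
    have := h (π.symm j.succ) (π.symm j.castSucc) (fun l hl hle => ?_) j hj (by simp)
    · simp [Fin.le_def] at this
    · have hne : l ≠ j := fun h => hA (h ▸ hl)
      simp only [Equiv.apply_symm_apply, Fin.le_def, Fin.val_castSucc, Fin.val_succ, ne_eq,
        Fin.ext_iff] at hle hne ⊢
      omega
  · intro h x y hxy j hj
    exact hxy j (h hj)

theorem part_univ (π : Equiv.Perm (Fin (d + 1))) : part π univ = ofPerm π := by
  refine eq_of_lvl_le_iff fun x y => ?_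
  simp only [lvl_part, lvl_ofPerm, sepCount_le_iff, mem_univ, true_imp_iff]
  constructor
  · intro h
    by_contra! hlt
    have := h ⟨π y, by omega⟩ (by simp)
    simp only [Fin.le_def, Fin.val_castSucc] at this
    omega
  · intro h j hj
    exact le_trans h hj

theorem part_empty (π : Equiv.Perm (Fin (d + 1))) : part π ∅ = ⊤ :=
  eq_of_lvl_le_iff fun x y => by simp [sepCount]

theorem ofPerm_le_part (π : Equiv.Perm (Fin (d + 1))) (A : Finset (Fin d)) :
    ofPerm π ≤ part π A := by
  rw [← part_univ, part_le_part_iff]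
  exact subset_univ A

/-- Every element of the interval `[ofPerm π, ⊤]` is given by its set of separators. -/
theorem exists_eq_part_of_ofPerm_le {π : Equiv.Perm (Fin (d + 1))} {T : OrderedPartition d}
    (h : ofPerm π ≤ T) : ∃ A, T = part π A := by
  set g : Fin (d + 1) → ℕ := fun p => T.lvl (π.symm p) with hg
  have hmono : Monotone g := fun p q hpq => le_iff.mp h _ _ (by simpa using hpq)
  have hstep : ∀ p q, g p < g q →
      ∃ j : Fin d, g j.castSucc < g j.succ ∧ p ≤ j.castSucc ∧ j.castSucc < q := by
    intro p q
    induction q using Fin.induction with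
    | zero => exact fun h => absurd h (not_lt.mpr (hmono (Fin.zero_le p)))
    | succ j ih =>
      intro hlt
      rcases lt_or_ge (g p) (g j.castSucc) with h' | h'
      · obtain ⟨l, h1, h2, h3⟩ := ih h'
        exact ⟨l, h1, h2, h3.trans Fin.castSucc_lt_succ⟩
      · refine ⟨j, h'.trans_lt hlt, ?_, Fin.castSucc_lt_succ⟩
        have hp : p < j.succ := not_le.mp fun hle => absurd hlt (not_lt.mpr (hmono hle))
        rwa [← Fin.le_castSucc_iff] at hp
  refine ⟨({j | g j.castSucc < g j.succ} : Finset (Fin d)), eq_of_lvl_le_iff fun x y => ?_⟩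
  rw [← not_lt, ← not_lt, lvl_part, lvl_part, sepCount_lt_iff, not_iff_not]
  have hgx : ∀ z, T.lvl z = g (π z) := fun z => by simp [hg]
  rw [hgx, hgx]
  constructor
  · intro hlt
    obtain ⟨j, h1, h2, h3⟩ := hstep _ _ hlt
    exact ⟨j, by simpa using h1, h2, h3⟩
  · rintro ⟨j, h1, h2, h3⟩
    have h1' : g j.castSucc < g j.succ := by simpa using h1
    exact (hmono h2).trans_lt (h1'.trans_le (hmono (Fin.castSucc_lt_iff_succ_le.mp h3)))

theorem exists_eq_part (T : OrderedPartition d) : ∃ π A, T = part π A := by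
  refine ⟨(Tuple.sort T.lvl).symm, exists_eq_part_of_ofPerm_le (le_iff.mpr fun x y hxy => ?_)⟩
  have := Tuple.monotone_sort T.lvl (show (Tuple.sort T.lvl).symm x ≤ (Tuple.sort T.lvl).symm y by
    simpa using hxy)
  simpa using this

instance : Finite (OrderedPartition d) :=
  Finite.of_surjective (fun p : Equiv.Perm (Fin (d + 1)) × Finset (Fin d) => part p.1 p.2)
    fun T => by
      obtain ⟨π, A, h⟩ := T.exists_eq_part
      exact ⟨(π, A), h.symm⟩

end OrderedPartition

open OrderedPartition

variable {d : ℕ}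

theorem locallySubmodular_iff {b : OrderedPartition d → ℝ} :
    LocallySubmodular b ↔ ∀ π (A B : Finset (Fin d)),
      b (part π (A ∩ B)) + b (part π (A ∪ B)) ≤ b (part π A) + b (part π B) := by
  have hlub : ∀ (π : Equiv.Perm (Fin (d + 1))) (A B : Finset (Fin d)),
      IsLUB {(⟨part π A, ofPerm_le_part π A, le_top⟩ : Set.Icc (ofPerm π) ⊤),
        ⟨part π B, ofPerm_le_part π B, le_top⟩} ⟨part π (A ∩ B), ofPerm_le_part _ _, le_top⟩ := by
    intro π A B
    constructor
    · rintro _ (rfl | rfl)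
      · exact part_le_part_iff.mpr inter_subset_left
      · exact part_le_part_iff.mpr inter_subset_right
    · rintro ⟨U, hU, _⟩ h
      obtain ⟨C, rfl⟩ := exists_eq_part_of_ofPerm_le hU
      exact part_le_part_iff.mpr (subset_inter (part_le_part_iff.mp (h (Or.inl rfl)))
        (part_le_part_iff.mp (h (Or.inr rfl))))
  have hglb : ∀ (π : Equiv.Perm (Fin (d + 1))) (A B : Finset (Fin d)),
      IsGLB {(⟨part π A, ofPerm_le_part π A, le_top⟩ : Set.Icc (ofPerm π) ⊤),
        ⟨part π B, ofPerm_le_part π B, le_top⟩} ⟨part π (A ∪ B), ofPerm_le_part _ _, le_top⟩ := by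
    intro π A B
    constructor
    · rintro _ (rfl | rfl)
      · exact part_le_part_iff.mpr subset_union_left
      · exact part_le_part_iff.mpr subset_union_right
    · rintro ⟨U, hU, _⟩ h
      obtain ⟨C, rfl⟩ := exists_eq_part_of_ofPerm_le hU
      exact part_le_part_iff.mpr (union_subset (part_le_part_iff.mp (h (Or.inl rfl)))
        (part_le_part_iff.mp (h (Or.inr rfl))))
  constructor
  · intro h π A B
    exact h π _ _ _ _ (hlub π A B) (hglb π A B)
  · rintro h π ⟨S, hS, hS'⟩ ⟨T, hT, hT'⟩ J M hJ hM
    obtain ⟨A, rfl⟩ := exists_eq_part_of_ofPerm_le hS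
    obtain ⟨B, rfl⟩ := exists_eq_part_of_ofPerm_le hT
    rw [hJ.unique (hlub π A B), hM.unique (hglb π A B)]
    exact h π A B

/-! ### The ren condition in terms of separators -/

/-- The separators next to `i`. -/
def neighbors (i : Fin d) : Finset (Fin d) := {j | (j : ℕ) + 1 = i ∨ (i : ℕ) + 1 = j}

theorem neighbors_subset (i : Fin d) : neighbors i ⊆ {i}ᶜ := fun j hj => by
  simp only [neighbors, mem_filter, mem_univ, true_and, mem_compl, mem_singleton] at hj ⊢
  rintro rfl
  omega

/-- The permutation obtained from `π` by exchanging the elements at the two positions next to the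
separator `i`. -/
def swapAt (π : Equiv.Perm (Fin (d + 1))) (i : Fin d) : Equiv.Perm (Fin (d + 1)) :=
  π.trans (Equiv.swap i.castSucc i.succ)

theorem castSucc_lt_swap_iff {i j : Fin d} (h : j ≠ i) (p : Fin (d + 1)) :
    j.castSucc < Equiv.swap i.castSucc i.succ p ↔ j.castSucc < p := by
  have h' : (j : ℕ) ≠ i := fun e => h (Fin.ext e)
  rw [Equiv.swap_apply_def]
  split_ifs with h1 h2
  · subst h1
    simp only [Fin.lt_def, Fin.val_castSucc, Fin.val_succ]
    omega
  · subst h2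
    simp only [Fin.lt_def, Fin.val_castSucc, Fin.val_succ]
    omega
  · rfl

theorem part_swapAt (π : Equiv.Perm (Fin (d + 1))) {i : Fin d} {A : Finset (Fin d)} (h : i ∉ A) :
    part (swapAt π i) A = part π A := by
  refine eq_of_lvl_le_iff fun x y => ?_
  have : ∀ x, (part (swapAt π i) A).lvl x = (part π A).lvl x := fun x => by
    simp only [lvl_part, sepCount, swapAt, Equiv.trans_apply]
    congr 1
    refine filter_congr fun j hj => castSucc_lt_swap_iff ?_ _
    rintro rfl
    exact h hj
  rw [this, this]

theorem sepCount_compl_eq_iff {i : Fin d} {p q : Fin (d + 1)} (h : p < q) :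
    sepCount {i}ᶜ p = sepCount {i}ᶜ q ↔ p = i.castSucc ∧ q = i.succ := by
  have hle := sepCount_mono ({i}ᶜ : Finset (Fin d)) h.le
  constructor
  · intro he
    have hn : ∀ j : Fin d, j ≠ i → ¬ (p ≤ j.castSucc ∧ j.castSucc < q) := fun j hj hpq =>
      absurd (sepCount_lt_iff (A := {i}ᶜ).mpr ⟨j, by simpa using hj, hpq⟩) (by rw [he]; exact lt_irrefl _)
    have h1 := hn ⟨p, by omega⟩
    have h2 := hn ⟨q - 1, by omega⟩
    simp only [Fin.lt_def, Fin.le_def, Fin.ext_iff, Fin.val_castSucc, Fin.val_succ, ne_eq] at *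
    omega
  · rintro ⟨rfl, rfl⟩
    simp [sepCount_succ]

theorem sepCount_compl_eq_castSucc_iff {i : Fin d} {p : Fin (d + 1)} :
    sepCount {i}ᶜ p = sepCount {i}ᶜ i.castSucc ↔ p = i.castSucc ∨ p = i.succ := by
  rcases lt_trichotomy p i.castSucc with h | h | h
  · rw [sepCount_compl_eq_iff h]
    simp only [Fin.lt_def, Fin.ext_iff, Fin.val_castSucc, Fin.val_succ] at *
    omega
  · simp [h]
  · rw [eq_comm, sepCount_compl_eq_iff h]
    simp [h.ne']

theorem sepCount_neighbors_eq_castSucc_iff {i : Fin d} {p : Fin (d + 1)} :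
    sepCount (neighbors i) p = sepCount (neighbors i) i.castSucc ↔
      p = i.castSucc ∨ p = i.succ := by
  have hne : ∀ {p q : Fin (d + 1)} (j : Fin d), j ∈ neighbors i → p ≤ j.castSucc →
      j.castSucc < q → sepCount (neighbors i) p ≠ sepCount (neighbors i) q :=
    fun j hj h1 h2 => (sepCount_lt_iff.mpr ⟨j, hj, h1, h2⟩).ne
  constructor
  · intro h
    by_contra! hn
    obtain ⟨h1, h2⟩ := hn
    simp only [ne_eq, Fin.ext_iff, Fin.val_castSucc, Fin.val_succ] at h1 h2
    rcases Nat.lt_or_ge p i with hp | hp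
    · refine hne ⟨i - 1, by omega⟩ ?_ ?_ ?_ h <;>
        (simp [neighbors, Fin.lt_def, Fin.le_def]; omega)
    · refine hne ⟨i + 1, by omega⟩ ?_ ?_ ?_ h.symm <;>
        (simp [neighbors, Fin.lt_def, Fin.le_def]; try omega)
  · rintro (rfl | rfl)
    · rfl
    · have hi : i ∉ neighbors i := fun h => by simpa using neighbors_subset i h
      rw [sepCount_succ, if_neg hi, add_zero]

theorem idx_eq_idx_iff {T : OrderedPartition d} {x y : Fin (d + 1)} :
    T.idx x = T.idx y ↔ T.lvl x = T.lvl y := Fin.ext_iff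

theorem mem_block_part_compl_iff (π : Equiv.Perm (Fin (d + 1))) (i : Fin d) (x : Fin (d + 1)) :
    x ∈ (part π {i}ᶜ).block ((part π {i}ᶜ).idx (π.symm i.castSucc)) ↔
      π x = i.castSucc ∨ π x = i.succ := by
  rw [mem_block_iff, idx_eq_idx_iff, lvl_part, lvl_part, Equiv.apply_symm_apply,
    sepCount_compl_eq_castSucc_iff]

theorem idx_eq_zero_iff (π : Equiv.Perm (Fin (d + 1))) (i : Fin d) :
    (((part π {i}ᶜ).idx (π.symm i.castSucc) : ℕ) = 0) ↔ (i : ℕ) = 0 := by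
  change (part π {i}ᶜ).lvl _ = 0 ↔ _
  have key := sepCount_compl_eq_castSucc_iff (i := i) (p := 0)
  rw [sepCount_zero, eq_comm] at key
  rw [lvl_part, Equiv.apply_symm_apply, key]
  simp [Fin.ext_iff, eq_comm]

theorem eq_idx_of_card_block_eq_two (π : Equiv.Perm (Fin (d + 1))) (i : Fin d)
    {β : Fin (part π {i}ᶜ).k} (h : #((part π {i}ᶜ).block β) = 2) :
    β = (part π {i}ᶜ).idx (π.symm i.castSucc) := by
  obtain ⟨x, y, hxy, he⟩ := Finset.card_eq_two.mp h
  have hx : (part π {i}ᶜ).idx x = β := mem_block_iff.mp (by simp [he])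
  have hy : (part π {i}ᶜ).idx y = β := mem_block_iff.mp (by simp [he])
  have key : ∀ x y, π x < π y → (part π {i}ᶜ).idx x = β → (part π {i}ᶜ).idx y = β →
      β = (part π {i}ᶜ).idx (π.symm i.castSucc) := by
    intro x y hlt hx hy
    have hs := idx_eq_idx_iff.mp (hx.trans hy.symm)
    rw [lvl_part, lvl_part, sepCount_compl_eq_iff hlt] at hs
    rw [← hx, ← hs.1, Equiv.symm_apply_apply]
  rcases lt_or_gt_of_ne (fun h => hxy (π.injective h)) with hlt | hlt
  · exact key x y hlt hx hy
  · exact key y x hlt hy hx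

theorem card_block_eq_two (π : Equiv.Perm (Fin (d + 1))) (i : Fin d) :
    #((part π {i}ᶜ).block ((part π {i}ᶜ).idx (π.symm i.castSucc))) = 2 := by
  rw [Finset.card_eq_two]
  refine ⟨π.symm i.castSucc, π.symm i.succ, ?_, ?_⟩
  · simp [Fin.ext_iff]
  · ext x
    rw [mem_block_part_compl_iff]
    simp [Equiv.eq_symm_apply]

theorem isGreatest_part_neighbors (π : Equiv.Perm (Fin (d + 1))) (i : Fin d) :
    IsGreatest {U | part π {i}ᶜ ≤ U ∧ ∃ j, U.block j =
      (part π {i}ᶜ).block ((part π {i}ᶜ).idx (π.symm i.castSucc))} (part π (neighbors i)) := by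
  refine ⟨⟨part_le_part_iff.mpr (neighbors_subset i),
    (part π (neighbors i)).idx (π.symm i.castSucc), ?_⟩, ?_⟩
  · ext x
    rw [mem_block_part_compl_iff, mem_block_iff, idx_eq_idx_iff, lvl_part, lvl_part,
      Equiv.apply_symm_apply, sepCount_neighbors_eq_castSucc_iff]
  · rintro U ⟨hU, β, hβ⟩
    obtain ⟨B, rfl⟩ := exists_eq_part_of_ofPerm_le ((ofPerm_le_part π _).trans hU)
    rw [part_le_part_iff]
    have hmem : ∀ p, (part π B).idx (π.symm p) = β ↔ p = i.castSucc ∨ p = i.succ := fun p => by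
      rw [← mem_block_iff, hβ, mem_block_part_compl_iff, Equiv.apply_symm_apply]
    have hstep : ∀ j : Fin d, j ∉ B →
        (part π B).idx (π.symm j.castSucc) = (part π B).idx (π.symm j.succ) := fun j hj => by
      rw [idx_eq_idx_iff]
      simp [sepCount_succ, hj]
    intro j hj
    by_contra hjB
    have hs := hstep j hjB
    have h1 := hmem j.castSucc
    have h2 := hmem j.succ
    rw [hs, h2] at h1
    simp only [neighbors, mem_filter, mem_univ, true_and, Fin.ext_iff, Fin.val_castSucc,
      Fin.val_succ] at hj h1
    omega

theorem eq_or_eq_swapAt {π ρ : Equiv.Perm (Fin (d + 1))} {i : Fin d}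
    (h : ofPerm ρ ≤ part π {i}ᶜ) : ρ = π ∨ ρ = swapAt π i := by
  have hid : ∀ κ : Equiv.Perm (Fin (d + 1)), StrictMono κ → κ = 1 := fun κ hκ =>
    Equiv.ext fun _ => hκ.apply_eq
  have hlt : ∀ p q, p < q → ¬ (p = i.castSucc ∧ q = i.succ) → ρ (π.symm p) < ρ (π.symm q) := by
    intro p q hpq hne
    by_contra! hle
    have := le_iff.mp h _ _ (by simpa using hle)
    simp only [lvl_part, Equiv.apply_symm_apply] at this
    exact hne ((sepCount_compl_eq_iff hpq).mp (le_antisymm (sepCount_mono _ hpq.le) this))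
  have hne : i.castSucc ≠ i.succ := by simp [Fin.ext_iff]
  rcases lt_or_gt_of_ne (a := ρ (π.symm i.castSucc)) (b := ρ (π.symm i.succ))
    (fun he => hne (π.symm.injective (ρ.injective he))) with hi | hi
  · left
    have := hid (π.symm.trans ρ) fun p q hpq => by
      by_cases hc : p = i.castSucc ∧ q = i.succ
      · rw [hc.1, hc.2]; exact hi
      · exact hlt p q hpq hc
    ext x
    have hx := congrArg (fun κ : Equiv.Perm (Fin (d + 1)) => κ (π x)) this
    simpa using congrArg Fin.val hx
  · right
    have := hid ((Equiv.swap i.castSucc i.succ).trans (π.symm.trans ρ)) fun p q hpq => by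
      simp only [Equiv.trans_apply]
      by_cases hc : p = i.castSucc ∧ q = i.succ
      · rw [hc.1, hc.2, Equiv.swap_apply_left, Equiv.swap_apply_right]; exact hi
      · refine hlt _ _ ?_ ?_
        · simp only [Equiv.swap_apply_def, Fin.lt_def, Fin.ext_iff, Fin.val_castSucc,
            Fin.val_succ] at hpq hc ⊢
          split_ifs <;> (try simp only [Fin.val_castSucc, Fin.val_succ]) <;> omega
        · rintro ⟨h1, h2⟩
          rw [Equiv.swap_apply_eq_iff, Equiv.swap_apply_left] at h1
          rw [Equiv.swap_apply_eq_iff, Equiv.swap_apply_right] at h2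
          subst h1 h2
          simp [Fin.lt_def] at hpq
    ext x
    have hx := congrArg (fun κ : Equiv.Perm (Fin (d + 1)) => κ (swapAt π i x)) this
    simpa [swapAt] using congrArg Fin.val hx

theorem rank_part (π : Equiv.Perm (Fin (d + 1))) (A : Finset (Fin d)) :
    (part π A).rank = #Aᶜ := by
  rw [Finset.card_compl, Fintype.card_fin]
  simp only [rank, part]
  omega

/-- An element of rank zero is a partition into singletons. -/
theorem exists_eq_ofPerm_of_rank_eq_zero {T : OrderedPartition d} (h : T.rank = 0) :
    ∃ π, T = ofPerm π := by
  obtain ⟨π, A, rfl⟩ := T.exists_eq_part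
  refine ⟨π, ?_⟩
  rw [rank_part, Finset.card_eq_zero, Finset.compl_eq_empty_iff] at h
  rw [h, part_univ]

theorem rank_ofPerm (π : Equiv.Perm (Fin (d + 1))) : (ofPerm π).rank = 0 := by
  simp [← part_univ, rank_part]

theorem renCondition_iff {b : OrderedPartition d → ℝ} :
    RenCondition b ↔ ∀ π (i : Fin d), 2 * b (part π {i}ᶜ) + b (part π (neighbors i)) ≤
      b (ofPerm π) + b (ofPerm (swapAt π i)) + if (i : ℕ) = 0 then 0 else b ⊤ := by
  constructor
  · intro h π i
    have hrank : (part π {i}ᶜ).rank = 1 := by simp [rank_part]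
    have hle : ofPerm (swapAt π i) ≤ part π {i}ᶜ := by
      rw [← part_swapAt π (i := i) (by simp)]
      exact ofPerm_le_part _ _
    have hne : ofPerm π ≠ ofPerm (swapAt π i) := fun he => by
      have := congrArg (fun T => T.lvl (π.symm i.castSucc)) he
      simp [swapAt] at this
    have := h _ hrank _ _ _ _ (card_block_eq_two π i) (rank_ofPerm _) (rank_ofPerm _) hne
      (ofPerm_le_part π _) hle (isGreatest_part_neighbors π i)
    simpa only [idx_eq_zero_iff] using this
  · intro h T hT β T₀ T₀' S hβ h0 h0' hne hle hle' hS
    obtain ⟨π, rfl⟩ := exists_eq_ofPerm_of_rank_eq_zero h0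
    obtain ⟨ρ, rfl⟩ := exists_eq_ofPerm_of_rank_eq_zero h0'
    obtain ⟨A, rfl⟩ := exists_eq_part_of_ofPerm_le hle
    rw [rank_part, Finset.card_eq_one] at hT
    obtain ⟨i, hi⟩ := hT
    obtain rfl : A = {i}ᶜ := by rw [← hi, compl_compl]
    obtain rfl := eq_idx_of_card_block_eq_two π i hβ
    rcases eq_or_eq_swapAt hle' with rfl | rfl
    · exact absurd rfl hne
    rw [hS.unique (isGreatest_part_neighbors π i)]
    simp only [idx_eq_zero_iff]
    exact h π i

/-! ### The vectors `e_T` -/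

/-- The indicator vector of the elements that `π` places after the separator `j`. -/
def step (π : Equiv.Perm (Fin (d + 1))) (j : Fin d) : Fin (d + 1) → ℝ :=
  fun x => if j.castSucc < π x then 1 else 0

theorem e_part (π : Equiv.Perm (Fin (d + 1))) (A : Finset (Fin d)) :
    (part π A).e = 1 + ∑ j ∈ A, step π j := by
  funext x
  simp [e_apply, sepCount, step, add_comm]

theorem e_part_inter_add_union (π : Equiv.Perm (Fin (d + 1))) (A B : Finset (Fin d)) :
    (part π (A ∩ B)).e + (part π (A ∪ B)).e = (part π A).e + (part π B).e := by
  have := Finset.sum_union_inter (s₁ := A) (s₂ := B) (f := step π)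
  simp only [e_part]
  linear_combination (exp := 1) this

theorem e_top : (⊤ : OrderedPartition d).e = 1 := by
  funext x
  simp [e_apply]

theorem e_insert {π : Equiv.Perm (Fin (d + 1))} {A : Finset (Fin d)} {j : Fin d} (h : j ∉ A) :
    (part π (insert j A)).e = (part π A).e + step π j := by
  rw [e_part, e_part, Finset.sum_insert h]
  abel

theorem eq_sum_firstDiff_smul_step (π : Equiv.Perm (Fin (d + 1))) (u : Fin (d + 1) → ℝ) :
    u = u (π.symm 0) • 1 + ∑ j, firstDiff π u j • step π j := by
  have key : ∀ p, u (π.symm p) =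
      u (π.symm 0) + ∑ j : Fin d, if j.castSucc < p then firstDiff π u j else 0 := by
    intro p
    induction p using Fin.induction with
    | zero => simp
    | succ i ih =>
      have : ∀ j : Fin d, (if j.castSucc < i.succ then firstDiff π u j else 0) =
          (if j.castSucc < i.castSucc then firstDiff π u j else 0) +
            if j = i then firstDiff π u j else 0 := by
        intro j
        have h1 : j.castSucc < i.succ ↔ j.castSucc < i.castSucc ∨ j = i := by
          simp only [Fin.lt_def, Fin.ext_iff, Fin.val_castSucc, Fin.val_succ]
          omega
        by_cases h : j = i
        · subst h; simp
        · simp [h1, h]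
      rw [Finset.sum_congr rfl fun j _ => this j, Finset.sum_add_distrib, ← add_assoc, ← ih]
      simp [firstDiff]
  funext x
  have := key (π x)
  rw [Equiv.symm_apply_apply] at this
  rw [this]
  simp [step]

theorem dotProduct_eq_sum (π : Equiv.Perm (Fin (d + 1))) (u v : Fin (d + 1) → ℝ) :
    u ⬝ᵥ v = u (π.symm 0) * (1 ⬝ᵥ v) + ∑ j, firstDiff π u j * (step π j ⬝ᵥ v) := by
  conv_lhs => rw [eq_sum_firstDiff_smul_step π u]
  rw [add_dotProduct, smul_dotProduct, sum_dotProduct]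
  simp only [smul_dotProduct, smul_eq_mul]

/-- The products of a point with `𝟏` and with the vectors `step π j` can be prescribed. -/
theorem exists_dotProduct_eq (π : Equiv.Perm (Fin (d + 1))) (N : ℝ) (z : Fin d → ℝ) :
    ∃ v : Fin (d + 1) → ℝ, 1 ⬝ᵥ v = N ∧ ∀ j, step π j ⬝ᵥ v = z j := by
  obtain ⟨Z, hZ0, hZ, hZd⟩ : ∃ Z : ℕ → ℝ, Z 0 = N ∧ (∀ j : Fin d, Z (j + 1) = z j) ∧
      Z (d + 1) = 0 := by
    refine ⟨fun k => if k = 0 then N else if h : k - 1 < d then z ⟨k - 1, h⟩ else 0, ?_, ?_, ?_⟩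
    · simp
    · intro j; simp
    · simp
  refine ⟨fun x => Z (π x) - Z (π x + 1), ?_, fun j => ?_⟩
  · rw [one_dotProduct, Equiv.sum_comp π fun p => Z (p : ℕ) - Z (p + 1),
      Fin.sum_univ_eq_sum_range (fun p => Z p - Z (p + 1)), Finset.sum_range_sub', hZ0, hZd,
      sub_zero]
  · have key : ∀ n, ∑ p ∈ range n, (if (j : ℕ) < p then Z p - Z (p + 1) else 0) =
        if (j : ℕ) < n then Z (j + 1) - Z n else 0 := by
      intro n
      induction n with
      | zero => simp
      | succ n ih =>
        rw [Finset.sum_range_succ, ih]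
        rcases lt_trichotomy (j : ℕ) n with h | h | h
        · simp [h, h.trans (Nat.lt_succ_self n)]
        · simp [h]
        · simp [h.not_gt, show ¬ (j : ℕ) < n + 1 by omega]
    have h1 : step π j ⬝ᵥ (fun x => Z (π x) - Z (π x + 1)) =
        ∑ p : Fin (d + 1), if (j : ℕ) < p then Z p - Z (p + 1) else 0 := by
      rw [← Equiv.sum_comp π]
      simp [dotProduct, step, Fin.lt_def]
    rw [h1, Fin.sum_univ_eq_sum_range (fun p => if (j : ℕ) < p then Z p - Z (p + 1) else 0), key,
      if_pos (by omega), hZ, hZd, sub_zero]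

theorem sepCount_compl (i : Fin d) (p : Fin (d + 1)) :
    (sepCount {i}ᶜ p + if i.castSucc < p then 1 else 0) = (p : ℕ) := by
  induction p using Fin.induction with
  | zero => simp [sepCount_zero]
  | succ j ih =>
    rw [sepCount_succ]
    simp only [mem_compl, mem_singleton, Fin.lt_def, Fin.ext_iff, Fin.val_castSucc,
      Fin.val_succ] at ih ⊢
    split_ifs at ih ⊢ <;> omega

theorem sepCount_neighbors (i : Fin d) (p : Fin (d + 1)) :
    sepCount (neighbors i) p = (if 0 < (i : ℕ) ∧ (i : ℕ) ≤ p then 1 else 0) +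
      if (i : ℕ) + 1 < p then 1 else 0 := by
  induction p using Fin.induction with
  | zero => simp [sepCount_zero]; omega
  | succ j ih =>
    rw [sepCount_succ]
    simp only [neighbors, mem_filter, mem_univ, true_and, Fin.val_castSucc,
      Fin.val_succ] at ih ⊢
    split_ifs at ih ⊢ <;> omega

/-- The linear relation between the ray generators on the two sides of the wall that separates the
braid cones of `π` and `swapAt π i`. -/
theorem e_ofPerm_add_e_ofPerm_swapAt (π : Equiv.Perm (Fin (d + 1))) (i : Fin d) :
    (ofPerm π).e + (ofPerm (swapAt π i)).e + (if (i : ℕ) = 0 then 0 else 1) =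
      2 • (part π {i}ᶜ).e + (part π (neighbors i)).e := by
  funext x
  have key : (π x : ℕ) + Equiv.swap i.castSucc i.succ (π x) + 2 + (if (i : ℕ) = 0 then 0 else 1) =
      2 * (sepCount {i}ᶜ (π x) + 1) + (sepCount (neighbors i) (π x) + 1) := by
    have h1 := sepCount_compl i (π x)
    rw [sepCount_neighbors]
    simp only [Equiv.swap_apply_def, Fin.lt_def, Fin.ext_iff, Fin.val_castSucc,
      Fin.val_succ] at h1 ⊢
    split_ifs at h1 ⊢ <;> (try simp only [Fin.val_castSucc, Fin.val_succ]) <;> omega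
  have key' := congrArg (Nat.cast : ℕ → ℝ) key
  push_cast at key'
  split_ifs with h <;>
  · simp only [h, if_true, if_false] at key'
    simp [e_apply, swapAt]
    linear_combination key'

/-! ### Sorting and summation by parts -/

/-- The separators to which `τ` assigns a value at least `k`. -/
def upperSep (τ : Equiv.Perm (Fin d)) (k : ℕ) : Finset (Fin d) := {j | k ≤ (τ j : ℕ)}

@[simp]
theorem mem_upperSep {τ : Equiv.Perm (Fin d)} {k : ℕ} {j : Fin d} :
    j ∈ upperSep τ k ↔ k ≤ (τ j : ℕ) := by
  simp [upperSep]

theorem upperSep_zero (τ : Equiv.Perm (Fin d)) : upperSep τ 0 = univ := by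
  ext; simp

theorem upperSep_eq_empty (τ : Equiv.Perm (Fin d)) {k : ℕ} (h : d ≤ k) : upperSep τ k = ∅ := by
  ext j
  have := (τ j).isLt
  simp
  omega

theorem insert_upperSep (τ : Equiv.Perm (Fin d)) (j : Fin d) :
    insert j (upperSep τ (τ j + 1)) = upperSep τ (τ j) := by
  ext l
  have : l = j ↔ (τ l : ℕ) = τ j := by rw [← Fin.ext_iff, τ.apply_eq_iff_eq]
  simp only [mem_insert, mem_upperSep, this]
  omega

theorem notMem_upperSep (τ : Equiv.Perm (Fin d)) (j : Fin d) : j ∉ upperSep τ (τ j + 1) := by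
  simp

/-- Summation by parts: a sum with increasing weights is bounded below in terms of the tail sums. -/
theorem mul_sum_le_sum_mul_fin {n : ℕ} {Y δ : Fin n → ℝ} (hY : Monotone Y)
    (hδ : ∀ k : ℕ, 0 ≤ ∑ j : Fin n, if k ≤ (j : ℕ) then δ j else 0) {c : ℝ} (hc : ∀ j, c ≤ Y j) :
    c * ∑ j, δ j ≤ ∑ j, Y j * δ j := by
  induction n generalizing c with
  | zero => simp
  | succ n ih =>
    have h0 : 0 ≤ ∑ j, δ j := by simpa using hδ 0
    have h := ih (Y := fun j => Y j.succ) (δ := fun j => δ j.succ)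
      (fun a b hab => hY (Fin.succ_le_succ_iff.mpr hab))
      (fun k => by simpa [Fin.sum_univ_succ] using hδ (k + 1)) (c := Y 0)
      (fun j => hY (Fin.zero_le _))
    calc c * ∑ j, δ j ≤ Y 0 * ∑ j, δ j := mul_le_mul_of_nonneg_right (hc 0) h0
      _ = Y 0 * δ 0 + Y 0 * ∑ j : Fin n, δ j.succ := by rw [Fin.sum_univ_succ, mul_add]
      _ ≤ Y 0 * δ 0 + ∑ j : Fin n, Y j.succ * δ j.succ := by gcongr
      _ = ∑ j, Y j * δ j := by rw [Fin.sum_univ_succ]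

theorem mul_sum_le_sum_mul {τ : Equiv.Perm (Fin d)} {Y δ : Fin d → ℝ}
    (hY : Monotone fun i => Y (τ.symm i)) (hδ : ∀ k, 0 ≤ ∑ j ∈ upperSep τ k, δ j) {c : ℝ}
    (hc : ∀ j, c ≤ Y j) : c * ∑ j, δ j ≤ ∑ j, Y j * δ j := by
  rw [← Equiv.sum_comp τ.symm δ, ← Equiv.sum_comp τ.symm fun j => Y j * δ j]
  refine mul_sum_le_sum_mul_fin hY (fun k => ?_) fun j => hc _
  have := hδ k
  rw [upperSep, Finset.sum_filter, ← Equiv.sum_comp τ.symm] at this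
  simpa using this

/-- The vector `u` represents a point of the cone `σ(π, τ)`. -/
def Sorted (π : Equiv.Perm (Fin (d + 1))) (τ : Equiv.Perm (Fin d)) (u : Fin (d + 1) → ℝ) : Prop :=
  Monotone (fun i => u (π.symm i)) ∧ Monotone (fun i => firstDiff π u (τ.symm i))

theorem firstDiff_nonneg {π : Equiv.Perm (Fin (d + 1))} {u : Fin (d + 1) → ℝ}
    (h : Monotone fun i => u (π.symm i)) (j : Fin d) : 0 ≤ firstDiff π u j :=
  sub_nonneg.mpr (h Fin.castSucc_lt_succ.le)

theorem monotone_of_firstDiff_nonneg {π : Equiv.Perm (Fin (d + 1))} {u : Fin (d + 1) → ℝ}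
    (h : ∀ j, 0 ≤ firstDiff π u j) : Monotone fun i => u (π.symm i) :=
  Fin.monotone_iff_le_succ.mpr fun j => sub_nonneg.mp (h j)

theorem exists_monotone_comp_symm {n : ℕ} (g : Fin n → ℝ) :
    ∃ τ : Equiv.Perm (Fin n), Monotone fun i => g (τ.symm i) :=
  ⟨(Tuple.sort g).symm, Tuple.monotone_sort g⟩

theorem exists_sorted (u : Fin (d + 1) → ℝ) : ∃ π τ, Sorted π τ u := by
  obtain ⟨π, hπ⟩ := exists_monotone_comp_symm u
  obtain ⟨τ, hτ⟩ := exists_monotone_comp_symm (firstDiff π u)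
  exact ⟨π, τ, hπ, hτ⟩

/-- To compare two linear functionals on a cone it suffices to compare them on its generators. The
generator `(ofPerm π).e` has a negative coefficient if `u` lies outside of the braid cone of `π`;
then equality is needed there. -/
theorem dotProduct_le_dotProduct {π : Equiv.Perm (Fin (d + 1))} {τ : Equiv.Perm (Fin d)}
    {u x v : Fin (d + 1) → ℝ} (hu : Monotone fun i => firstDiff π u (τ.symm i))
    (h1 : 1 ⬝ᵥ x = 1 ⬝ᵥ v)
    (hle : ∀ k, (part π (upperSep τ k)).e ⬝ᵥ x ≤ (part π (upperSep τ k)).e ⬝ᵥ v)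
    (h0 : (∀ j, 0 ≤ firstDiff π u j) ∨ (ofPerm π).e ⬝ᵥ x = (ofPerm π).e ⬝ᵥ v) :
    u ⬝ᵥ x ≤ u ⬝ᵥ v := by
  have hδ : ∀ k, 0 ≤ ∑ j ∈ upperSep τ k, (step π j ⬝ᵥ v - step π j ⬝ᵥ x) := fun k => by
    have := hle k
    simp only [e_part, add_dotProduct, sum_dotProduct, h1] at this
    rw [Finset.sum_sub_distrib]
    linarith
  have hsum : 0 ≤ ∑ j, firstDiff π u j * (step π j ⬝ᵥ v - step π j ⬝ᵥ x) := by
    rcases h0 with h0 | h0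
    · simpa using mul_sum_le_sum_mul hu hδ h0
    · obtain ⟨c, hc⟩ := Set.finite_range (firstDiff π u) |>.bddBelow
      have h := mul_sum_le_sum_mul hu hδ fun j => hc ⟨j, rfl⟩
      rw [← part_univ] at h0
      simp only [e_part, add_dotProduct, sum_dotProduct, h1] at h0
      rw [Finset.sum_sub_distrib, ← add_left_cancel h0, sub_self, mul_zero] at h
      exact h
  rw [dotProduct_eq_sum π u x, dotProduct_eq_sum π u v, h1]
  simp only [mul_sub, Finset.sum_sub_distrib] at hsum
  linarith

/-! ### The vertices -/

/-- The point `v` makes the inequalities of `b` tight at all generators of the cone `σ(π, τ)`. -/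
def IsVertexAt (b : OrderedPartition d → ℝ) (π : Equiv.Perm (Fin (d + 1)))
    (τ : Equiv.Perm (Fin d)) (v : Fin (d + 1) → ℝ) : Prop :=
  ∀ k, (part π (upperSep τ k)).e ⬝ᵥ v = b (part π (upperSep τ k))

variable {b : OrderedPartition d → ℝ} {π : Equiv.Perm (Fin (d + 1))} {τ : Equiv.Perm (Fin d)}
  {u v : Fin (d + 1) → ℝ}

theorem IsVertexAt.one_dotProduct (h : IsVertexAt b π τ v) : 1 ⬝ᵥ v = b ⊤ := by
  simpa [upperSep_eq_empty τ le_rfl, part_empty, e_top] using h d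

theorem IsVertexAt.ofPerm_dotProduct (h : IsVertexAt b π τ v) :
    (ofPerm π).e ⬝ᵥ v = b (ofPerm π) := by
  simpa [upperSep_zero, part_univ] using h 0

/-- Induction along the chain of the sets `upperSep τ k`, from the empty set upwards. -/
theorem upperSep_induction (τ : Equiv.Perm (Fin d)) {p : ℕ → Prop} (empty : ∀ k, d ≤ k → p k)
    (insert : ∀ j, p (τ j + 1) → p (τ j)) (k : ℕ) : p k := by
  have key : ∀ m k, d ≤ k + m → p k := by
    intro m
    induction m with
    | zero => exact fun k hk => empty k hk
    | succ m ih =>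
      intro k hk
      rcases Nat.lt_or_ge k d with h | h
      · simpa using insert (τ.symm ⟨k, h⟩) (by simpa using ih (k + 1) (by omega))
      · exact empty k h
  exact key d k (Nat.le_add_left d k)

theorem exists_isVertexAt (b : OrderedPartition d → ℝ) (π : Equiv.Perm (Fin (d + 1)))
    (τ : Equiv.Perm (Fin d)) : ∃ v, IsVertexAt b π τ v := by
  obtain ⟨v, h1, hv⟩ := exists_dotProduct_eq π (b ⊤) fun j =>
    b (part π (upperSep τ (τ j))) - b (part π (upperSep τ (τ j + 1)))
  refine ⟨v, upperSep_induction τ (fun k hk => ?_) fun j ih => ?_⟩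
  · rw [upperSep_eq_empty τ hk, part_empty, e_top, h1]
  · have h : (part π (upperSep τ (τ j))).e = (part π (upperSep τ (τ j + 1))).e + step π j := by
      rw [← insert_upperSep, e_insert (notMem_upperSep τ j)]
    rw [h, add_dotProduct, ih, hv]
    ring

/-- The greedy algorithm: by submodularity the vertex of a cone in the braid cone of `π`
satisfies all inequalities that belong to `π`. -/
theorem IsVertexAt.dotProduct_le (h : IsVertexAt b π τ v) (hb : LocallySubmodular b)
    (A : Finset (Fin d)) : (part π A).e ⬝ᵥ v ≤ b (part π A) := by
  rw [locallySubmodular_iff] at hb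
  suffices H : ∀ k, ∀ A ⊆ upperSep τ k, (part π A).e ⬝ᵥ v ≤ b (part π A) from
    H 0 A (by rw [upperSep_zero]; exact subset_univ A)
  refine upperSep_induction τ (fun k hk A hA => ?_) fun j ih A hA => ?_
  · have := h k
    rw [upperSep_eq_empty τ hk] at hA this
    rw [subset_empty.mp hA, this]
  · rw [← insert_upperSep] at hA
    by_cases hj : j ∈ A
    · have hI : A ∩ upperSep τ (τ j + 1) ⊆ upperSep τ (τ j + 1) := inter_subset_right
      have hU : A ∪ upperSep τ (τ j + 1) = upperSep τ (τ j) := by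
        rw [← insert_upperSep]
        ext l
        have := @hA l
        simp only [mem_union, mem_insert] at this ⊢
        grind
      have h1 := hb π A (upperSep τ (τ j + 1))
      have h2 := congrArg (· ⬝ᵥ v) (e_part_inter_add_union π A (upperSep τ (τ j + 1)))
      simp only [add_dotProduct] at h2
      have h3 := ih _ hI
      rw [hU] at h1 h2
      have h4 := h (τ j)
      have h5 := h (τ j + 1)
      linarith
    · exact ih A ((subset_insert_iff_of_notMem hj).mp hA)

theorem IsVertexAt.dotProduct_le_of_monotone {τ' : Equiv.Perm (Fin d)} {v' : Fin (d + 1) → ℝ}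
    (hv : IsVertexAt b π τ v) (hv' : IsVertexAt b π τ' v') (hb : LocallySubmodular b)
    (hu : Monotone fun i => firstDiff π u (τ.symm i)) : u ⬝ᵥ v' ≤ u ⬝ᵥ v :=
  dotProduct_le_dotProduct hu (hv'.one_dotProduct.trans hv.one_dotProduct.symm)
    (fun k => (hv'.dotProduct_le hb _).trans (hv k).ge)
    (Or.inr (hv'.ofPerm_dotProduct.trans hv.ofPerm_dotProduct.symm))

/-- Crossing the wall between the braid cones of `π` and `swapAt π i` towards `u` does not decrease
the product with `u`. This is where the ren condition is used. -/
theorem IsVertexAt.dotProduct_le_swapAt {i : Fin d} {v' : Fin (d + 1) → ℝ}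
    (hv : IsVertexAt b π τ v) (hv' : IsVertexAt b (swapAt π i) τ v') (hb : LocallySubmodular b)
    (hren : RenCondition b) (hi : (τ i : ℕ) = 0) (hu : firstDiff π u i ≤ 0) :
    u ⬝ᵥ v ≤ u ⬝ᵥ v' := by
  have hni : ∀ k, i ∉ upperSep τ (k + 1) := fun k => by simp [hi]
  have hk : ∀ k, (part π (upperSep τ (k + 1))).e ⬝ᵥ v' = b (part π (upperSep τ (k + 1))) :=
    fun k => by
      have := hv' (k + 1)
      rwa [part_swapAt π (hni k)] at this
  have hstep : ∀ j, j ≠ i → step π j ⬝ᵥ v = step π j ⬝ᵥ v' := by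
    intro j hj
    obtain ⟨m, hm⟩ : ∃ m, (τ j : ℕ) = m + 1 := by
      refine Nat.exists_eq_succ_of_ne_zero fun h0 => hj (τ.injective (Fin.ext ?_))
      rw [h0, hi]
    have h : (part π (upperSep τ (τ j))).e = (part π (upperSep τ (τ j + 1))).e + step π j := by
      rw [← insert_upperSep, e_insert (notMem_upperSep τ j)]
    have hs : ∀ w, step π j ⬝ᵥ w = (part π (upperSep τ (τ j))).e ⬝ᵥ w -
        (part π (upperSep τ (τ j + 1))).e ⬝ᵥ w := fun w => by
      rw [h, add_dotProduct]; ring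
    rw [hs, hs, hv, hv, hk, hm, hk]
  have hcompl : upperSep τ 1 = {i}ᶜ := by
    ext j
    have : j = i ↔ (τ j : ℕ) = τ i := by rw [← Fin.ext_iff, τ.apply_eq_iff_eq]
    simp only [mem_upperSep, mem_compl, mem_singleton, this, hi]
    omega
  have hT := hk 0
  have hT' := hv 1
  simp only [zero_add, hcompl] at hT hT'
  have hS := hv'.dotProduct_le hb (neighbors i)
  rw [part_swapAt π fun h => by simpa using neighbors_subset i h] at hS
  have hstepi : step π i ⬝ᵥ v' ≤ step π i ⬝ᵥ v := by
    have h : (ofPerm π).e = (part π {i}ᶜ).e + step π i := by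
      rw [← e_insert (by simp), ← part_univ, Finset.insert_compl_self]
    have hs : ∀ w, step π i ⬝ᵥ w = (ofPerm π).e ⬝ᵥ w - (part π {i}ᶜ).e ⬝ᵥ w := fun w => by
      rw [h, add_dotProduct]; ring
    rw [hs, hs, hT, hT', hv.ofPerm_dotProduct]
    have hrel := congrArg (· ⬝ᵥ v') (e_ofPerm_add_e_ofPerm_swapAt π i)
    have hr := renCondition_iff.mp hren π i
    have h1 := hv'.ofPerm_dotProduct
    have h2 := hv'.one_dotProduct
    simp only [add_dotProduct, smul_dotProduct, hT, h1] at hrel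
    split_ifs at hrel hr
    · rw [zero_dotProduct] at hrel
      simp only [nsmul_eq_mul, Nat.cast_ofNat] at hrel
      linarith
    · rw [h2] at hrel
      simp only [nsmul_eq_mul, Nat.cast_ofNat] at hrel
      linarith
  rw [dotProduct_eq_sum π u v, dotProduct_eq_sum π u v', hv.one_dotProduct, hv'.one_dotProduct]
  refine add_le_add le_rfl (Finset.sum_le_sum fun j _ => ?_)
  by_cases hj : j = i
  · subst hj
    exact mul_le_mul_of_nonpos_left hstepi hu
  · rw [hstep j hj]

/-- Walking through adjacent braid cones towards `u`, the product of the vertices with `u` does not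
decrease, and the walk ends in a cone that contains `u`. -/
theorem IsVertexAt.exists_sorted_dotProduct_le (hv : IsVertexAt b π τ v)
    (hb : LocallySubmodular b) (hren : RenCondition b) (u : Fin (d + 1) → ℝ) :
    ∃ π' τ' v', Sorted π' τ' u ∧ IsVertexAt b π' τ' v' ∧ u ⬝ᵥ v ≤ u ⬝ᵥ v' := by
  classical
  let s : Finset (Equiv.Perm (Fin (d + 1))) :=
    {π' | ∃ τ' v', IsVertexAt b π' τ' v' ∧ u ⬝ᵥ v ≤ u ⬝ᵥ v'}
  have hs : ∀ {π'}, π' ∈ s ↔ ∃ τ' v', IsVertexAt b π' τ' v' ∧ u ⬝ᵥ v ≤ u ⬝ᵥ v' := by simp [s]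
  -- The potential `∑ π(x) u(x)` increases strictly when a descent of `u` along `π` is swapped.
  obtain ⟨π', hπ', hmax⟩ := s.exists_max_image (fun κ => ∑ x, ((κ x : ℕ) : ℝ) * u x)
    ⟨π, hs.mpr ⟨τ, v, hv, le_rfl⟩⟩
  obtain ⟨τ₁, v₁, hv₁, hle₁⟩ := hs.mp hπ'
  obtain ⟨τ', hτ'⟩ := exists_monotone_comp_symm (firstDiff π' u)
  obtain ⟨v', hv'⟩ := exists_isVertexAt b π' τ'
  have hle' := hle₁.trans (hv'.dotProduct_le_of_monotone hv₁ hb hτ')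
  refine ⟨π', τ', v', ⟨monotone_of_firstDiff_nonneg ?_, hτ'⟩, hv', hle'⟩
  by_contra! hneg
  obtain ⟨j, hj⟩ := hneg
  have hd : 0 < d := j.pos
  set i := τ'.symm ⟨0, hd⟩ with hi
  have hi0 : (τ' i : ℕ) = 0 := by simp [hi]
  have hui : firstDiff π' u i < 0 := by
    refine lt_of_le_of_lt ?_ hj
    have := hτ' (show (⟨0, hd⟩ : Fin d) ≤ τ' j from Nat.zero_le _)
    simpa [hi] using this
  obtain ⟨v₂, hv₂⟩ := exists_isVertexAt b (swapAt π' i) τ'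
  have hmem : swapAt π' i ∈ s :=
    hs.mpr ⟨τ', v₂, hv₂, hle'.trans (hv'.dotProduct_le_swapAt hv₂ hb hren hi0 hui.le)⟩
  refine absurd (hmax _ hmem) (not_le.mpr ?_)
  have hne : i.castSucc ≠ i.succ := by simp [Fin.ext_iff]
  rw [← Equiv.sum_comp π'.symm fun x => ((π' x : ℕ) : ℝ) * u x,
    ← Equiv.sum_comp π'.symm fun x => ((swapAt π' i x : ℕ) : ℝ) * u x, ← sub_pos,
    ← Finset.sum_sub_distrib, Finset.sum_eq_add i.castSucc i.succ hne]
  · simp only [swapAt, Equiv.trans_apply, Equiv.apply_symm_apply, Equiv.swap_apply_left,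
      Equiv.swap_apply_right, Fin.val_succ, Fin.val_castSucc]
    rw [firstDiff] at hui
    push_cast
    linarith
  · rintro p - ⟨h1, h2⟩
    simp [swapAt, Equiv.swap_apply_of_ne_of_ne h1 h2]
  · simp
  · simp

theorem IsVertexAt.mem_solutionSet (hv : IsVertexAt b π τ v)
    (hb : LocallySubmodular b) (hren : RenCondition b) : v ∈ solutionSet b := by
  refine ⟨hv.one_dotProduct, fun T _ => ?_⟩
  obtain ⟨π', τ', v', hs, hv', hle⟩ := hv.exists_sorted_dotProduct_le hb hren T.e
  have hT : ofPerm π' ≤ T := le_iff.mpr fun x y hxy => by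
    have := hs.1 (show π' x ≤ π' y by simpa using hxy)
    simpa [e_apply] using this
  obtain ⟨A, rfl⟩ := exists_eq_part_of_ofPerm_le hT
  exact hle.trans (hv'.dotProduct_le hb A)

/-! ### Linearity of the support function on the cones of the nested Braid fan -/

/-- The support function `u ↦ max_{x ∈ P} ⟨u, x⟩` of `P` is linear on every cone `σ(π, τ)`: some
point of `P` attains the maximum for all `u` in the cone. -/
def SupportLinear (P : Set (Fin (d + 1) → ℝ)) : Prop :=
  ∀ π τ, ∃ v ∈ P, ∀ u, Sorted π τ u → ∀ x ∈ P, u ⬝ᵥ x ≤ u ⬝ᵥ v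

theorem e_dotProduct_le_of_mem {b : OrderedPartition d → ℝ} {x : Fin (d + 1) → ℝ}
    (hx : x ∈ solutionSet b) (T : OrderedPartition d) : T.e ⬝ᵥ x ≤ b T := by
  by_cases hT : T = ⊤
  · rw [hT, e_top, hx.1]
  · exact hx.2 T hT

theorem supportLinear_solutionSet {b : OrderedPartition d → ℝ} (hb : LocallySubmodular b)
    (hren : RenCondition b) : SupportLinear (solutionSet b) := fun π τ => by
  obtain ⟨v, hv⟩ := exists_isVertexAt b π τ
  refine ⟨v, hv.mem_solutionSet hb hren, fun u hu x hx => ?_⟩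
  exact dotProduct_le_dotProduct hu.2 (hx.1.trans hv.one_dotProduct.symm)
    (fun k => (e_dotProduct_le_of_mem hx _).trans (hv k).ge) (Or.inl (firstDiff_nonneg hu.1))

theorem SupportLinear.exists_forall_dotProduct_le {P : Set (Fin (d + 1) → ℝ)}
    (h : SupportLinear P) (u : Fin (d + 1) → ℝ) : ∃ v ∈ P, ∀ x ∈ P, u ⬝ᵥ x ≤ u ⬝ᵥ v := by
  obtain ⟨π, τ, hs⟩ := exists_sorted u
  obtain ⟨v, hv, hle⟩ := h π τ
  exact ⟨v, hv, hle u hs⟩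

theorem SupportLinear.isBounded {P : Set (Fin (d + 1) → ℝ)} (h : SupportLinear P) :
    Bornology.IsBounded P := by
  choose v _ hv using h.exists_forall_dotProduct_le
  refine (Metric.isBounded_Icc (fun j => -(-Pi.single j 1 ⬝ᵥ v (-Pi.single j 1)))
    (fun j => Pi.single j 1 ⬝ᵥ v (Pi.single j 1))).subset fun x hx => ⟨fun j => ?_, fun j => ?_⟩
  · have := hv (-Pi.single j 1) x hx
    rw [neg_dotProduct, single_one_dotProduct] at this
    linarith
  · simpa only [single_one_dotProduct] using hv (Pi.single j 1) x hx

theorem isPolyhedron_solutionSet (b : OrderedPartition d → ℝ) : IsPolyhedron (solutionSet b) := by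
  obtain ⟨m, ⟨ε⟩⟩ := Finite.exists_equiv_fin (Option (OrderedPartition d))
  refine ⟨m, fun i => (ε.symm i).elim (-1) OrderedPartition.e,
    fun i => (ε.symm i).elim (-b ⊤) b, ?_⟩
  ext x
  rw [Set.mem_ofPred_eq, ε.symm.forall_congr_left]
  simp only [Equiv.symm_symm, Equiv.symm_apply_apply, Option.forall, Option.elim]
  constructor
  · intro hx
    exact ⟨by rw [neg_dotProduct, hx.1], e_dotProduct_le_of_mem hx⟩
  · rintro ⟨h1, h2⟩
    refine ⟨le_antisymm (by simpa [e_top] using h2 ⊤) ?_, fun T _ => h2 T⟩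
    rw [neg_dotProduct] at h1
    exact neg_le_neg_iff.mp h1

/-! ### Cones in the quotient space -/

theorem toW_eq_toW_iff {u u' : Fin (d + 1) → ℝ} :
    toW d u = toW d u' ↔ ∃ c : ℝ, u = u' + c • 1 := by
  rw [toW, Submodule.mkQ_apply, Submodule.mkQ_apply, Submodule.Quotient.eq,
    Submodule.mem_span_singleton]
  exact exists_congr fun c => ⟨fun h => by rw [h]; abel, fun h => by rw [h]; abel⟩

theorem toW_surjective : Function.Surjective (toW d) := Submodule.mkQ_surjective _

/-- The first difference as a linear functional. -/
def firstDiffHom (π : Equiv.Perm (Fin (d + 1))) (j : Fin d) : (Fin (d + 1) → ℝ) →ₗ[ℝ] ℝ :=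
  LinearMap.proj (R := ℝ) (φ := fun _ => ℝ) (π.symm j.succ) -
    LinearMap.proj (R := ℝ) (φ := fun _ => ℝ) (π.symm j.castSucc)

/-- Linear functionals whose nonnegativity describes the cone `σ(π, τ)`. -/
def facetHom (π : Equiv.Perm (Fin (d + 1))) (τ : Equiv.Perm (Fin d)) :
    Fin d ⊕ {p : Fin d × Fin d // p.1 < p.2} → (Fin (d + 1) → ℝ) →ₗ[ℝ] ℝ
  | .inl j => firstDiffHom π j
  | .inr p => firstDiffHom π (τ.symm p.1.2) - firstDiffHom π (τ.symm p.1.1)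

theorem facetHom_one (π : Equiv.Perm (Fin (d + 1))) (τ : Equiv.Perm (Fin d))
    (c : Fin d ⊕ {p : Fin d × Fin d // p.1 < p.2}) : facetHom π τ c 1 = 0 := by
  rcases c with j | p <;> simp [facetHom, firstDiffHom]

variable {s : Fin (d + 1) → ℝ}

theorem sorted_iff_facetHom : Sorted π τ u ↔ ∀ c, 0 ≤ facetHom π τ c u := by
  have h1 : ∀ j, firstDiffHom π j u = firstDiff π u j := fun j => rfl
  simp only [Sum.forall, facetHom, LinearMap.sub_apply, h1, sub_nonneg, Subtype.forall,
    Prod.forall]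
  constructor
  · rintro ⟨h, h'⟩
    exact ⟨firstDiff_nonneg h, fun p q hpq => h' hpq.le⟩
  · rintro ⟨h, h'⟩
    refine ⟨monotone_of_firstDiff_nonneg h, fun p q hpq => ?_⟩
    rcases hpq.lt_or_eq with hlt | rfl
    · exact h' p q hlt
    · exact le_rfl

theorem toW_mem_nestedCone : toW d u ∈ nestedCone π τ ↔ Sorted π τ u := by
  constructor
  · rintro ⟨x, hx, hs⟩
    obtain ⟨c, rfl⟩ := toW_eq_toW_iff.mp hx.symm
    change Sorted π τ x at hs
    rw [sorted_iff_facetHom] at hs ⊢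
    intro i
    rw [map_add, map_smul, facetHom_one, smul_zero, add_zero]
    exact hs i
  · exact fun h => ⟨u, rfl, h⟩

/-- If `s` lies in the minimal face of the cone `σ(π, τ)` that contains `u`, then one can move from
`u` a little in the direction of `-s` without leaving the cone. -/
theorem Sorted.exists_sub_smul (hu : Sorted π τ u)
    (h : ∀ c, facetHom π τ c u = 0 → facetHom π τ c s = 0) :
    ∃ δ : ℝ, 0 < δ ∧ Sorted π τ (u - δ • s) := by
  have hev : ∀ c, ∀ᶠ δ : ℝ in nhdsWithin 0 (Set.Ioi 0), 0 ≤ facetHom π τ c (u - δ • s) := by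
    intro c
    simp only [map_sub, map_smul, smul_eq_mul]
    rcases (sorted_iff_facetHom.mp hu c).lt_or_eq with hc | hc
    · have hcont : Continuous fun δ : ℝ => facetHom π τ c u - δ * facetHom π τ c s := by fun_prop
      have := (hcont.tendsto 0).eventually_const_lt (u := 0) (by simpa using hc)
      exact (this.filter_mono nhdsWithin_le_nhds).mono fun _ => le_of_lt
    · simp [← hc, h c hc.symm]
  obtain ⟨δ, h1, h2⟩ := ((Filter.eventually_all.mpr hev).and self_mem_nhdsWithin).exists
  exact ⟨δ, h2, sorted_iff_facetHom.mpr h1⟩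

theorem toW_mem_ncone {P F : Set (Fin (d + 1) → ℝ)} {N : ℝ} (hN : ∀ x ∈ P, 1 ⬝ᵥ x = N)
    (hF : F ⊆ P) : toW d u ∈ ncone F P ↔ ∀ x ∈ F, ∀ y ∈ P, u ⬝ᵥ y ≤ u ⬝ᵥ x := by
  constructor
  · rintro ⟨u', hu', h⟩ x hx y hy
    obtain ⟨c, rfl⟩ := toW_eq_toW_iff.mp hu'.symm
    simpa [add_dotProduct, smul_dotProduct, hN x (hF hx), hN y hy] using h x hx y hy
  · exact fun h => ⟨u, rfl, h⟩

theorem exists_face_nestedCone (hu : Sorted π τ u) :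
    ∃ G, IsFace (nestedCone π τ) G ∧ toW d u ∈ G ∧ ∀ s, toW d s ∈ G →
      Sorted π τ s ∧ ∀ c, facetHom π τ c u = 0 → facetHom π τ c s = 0 := by
  classical
  set act : Finset (Fin d ⊕ {p : Fin d × Fin d // p.1 < p.2}) := {c | facetHom π τ c u = 0}
    with hact
  let ψ : (Fin (d + 1) → ℝ) →ₗ[ℝ] ℝ := -∑ c ∈ act, facetHom π τ c
  have hψ : ∀ s, ψ s = -∑ c ∈ act, facetHom π τ c s := fun s => by simp [ψ]
  have hker : Submodule.span ℝ {(1 : Fin (d + 1) → ℝ)} ≤ LinearMap.ker ψ := by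
    rw [Submodule.span_le, Set.singleton_subset_iff, SetLike.mem_coe, LinearMap.mem_ker, hψ]
    simp [facetHom_one]
  let φ : W d →ₗ[ℝ] ℝ := Submodule.liftQ _ ψ hker
  have hφ : ∀ s, φ (toW d s) = -∑ c ∈ act, facetHom π τ c s := fun s => by
    rw [← hψ]
    exact Submodule.liftQ_apply _ ψ s
  have hφu : φ (toW d u) = 0 := by
    rw [hφ, Finset.sum_eq_zero, neg_zero]
    intro c hc
    simpa [hact] using hc
  have hmem : toW d u ∈ {w | w ∈ nestedCone π τ ∧ ∀ y ∈ nestedCone π τ, φ y ≤ φ w} := by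
    refine ⟨toW_mem_nestedCone.mpr hu, fun y hy => ?_⟩
    obtain ⟨s, rfl⟩ := toW_surjective y
    rw [hφu, hφ, neg_nonpos]
    exact Finset.sum_nonneg fun c _ => sorted_iff_facetHom.mp (toW_mem_nestedCone.mp hy) c
  refine ⟨_, ⟨⟨_, hmem⟩, φ, rfl⟩, hmem, fun s hs => ?_⟩
  have hs' := toW_mem_nestedCone.mp hs.1
  refine ⟨hs', fun c hc => ?_⟩
  have h1 := hs.2 _ hmem.1
  have hnn := fun c (_ : c ∈ act) => sorted_iff_facetHom.mp hs' c
  rw [hφu, hφ, le_neg, neg_zero] at h1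
  have h2 := (Finset.sum_eq_zero_iff_of_nonneg hnn).mp (le_antisymm h1 (Finset.sum_nonneg hnn))
  exact h2 c (by simpa [hact] using hc)

theorem SupportLinear.isGeneralizedNestedPermutohedron {P : Set (Fin (d + 1) → ℝ)}
    (h : SupportLinear P) (hP : IsPolyhedron P) {N : ℝ} (hN : ∀ x ∈ P, 1 ⬝ᵥ x = N) :
    IsGeneralizedNestedPermutohedron P := by
  refine ⟨(h 1 1).imp fun v hv => hv.1, ⟨hP, h.isBounded⟩, ⟨N, hN⟩, ?_⟩
  rintro _ ⟨F, ⟨-, φ, hφ⟩, rfl⟩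
  have hF : F ⊆ P := fun x hx => (hφ ▸ hx).1
  refine ⟨{G | G ∈ nestedBraidFan d ∧ G ⊆ ncone F P}, fun G hG => hG.1, ?_⟩
  refine Set.Subset.antisymm (fun w hw => ?_) (Set.sUnion_subset fun G hG => hG.2)
  obtain ⟨u, rfl⟩ := toW_surjective w
  obtain ⟨π, τ, hu⟩ := exists_sorted u
  obtain ⟨G, hG, huG, hmin⟩ := exists_face_nestedCone hu
  refine ⟨G, ⟨⟨π, τ, hG⟩, fun w' hw' => ?_⟩, huG⟩
  obtain ⟨s, rfl⟩ := toW_surjective w'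
  obtain ⟨hs, hact⟩ := hmin s hw'
  obtain ⟨δ, hδ, hsub⟩ := hu.exists_sub_smul hact
  obtain ⟨v, hv, hle⟩ := h π τ
  rw [toW_mem_ncone hN hF] at hw ⊢
  intro x hx y hy
  have h1 := hw x hx v hv
  have h2 := hle _ hsub x (hF hx)
  simp only [sub_dotProduct, smul_dotProduct, smul_eq_mul] at h2
  have h3 : δ * (s ⬝ᵥ v) ≤ δ * (s ⬝ᵥ x) := by linarith
  exact (hle s hs y hy).trans (le_of_mul_le_mul_left h3 hδ)

theorem eq_of_strictMono_of_monotone {n : ℕ} {g : Fin n → ℝ} {κ κ' : Equiv.Perm (Fin n)}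
    (h : StrictMono fun i => g (κ.symm i)) (h' : Monotone fun i => g (κ'.symm i)) : κ' = κ := by
  have hmono : StrictMono (κ'.symm.trans κ) := by
    refine Monotone.strictMono_of_injective (fun p q hpq => ?_) (Equiv.injective _)
    refine h.le_iff_le.mp ?_
    simpa using h' hpq
  ext x
  have : (κ'.symm.trans κ) (κ' x) = κ' x := hmono.apply_eq
  simpa using congrArg Fin.val this.symm

theorem firstDiff_sum_smul_step (π : Equiv.Perm (Fin (d + 1))) (y : Fin d → ℝ) (i : Fin d) :
    firstDiff π (∑ j, y j • step π j) i = y i := by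
  simp only [firstDiff, Finset.sum_apply, Pi.smul_apply, step, Equiv.apply_symm_apply,
    smul_eq_mul]
  rw [← Finset.sum_sub_distrib, Finset.sum_eq_single i]
  · simp
  · intro j _ hj
    have : j.castSucc < i.succ ↔ j.castSucc < i.castSucc := by
      have : (j : ℕ) ≠ i := fun h => hj (Fin.ext h)
      simp only [Fin.lt_def, Fin.val_castSucc, Fin.val_succ]
      omega
    simp only [this, sub_self]
  · simp

/-- Every cone `σ(π, τ)` has a point that lies in no other cone `σ(π', τ')`, nor in a proper
face. -/
theorem exists_generic (π : Equiv.Perm (Fin (d + 1))) (τ : Equiv.Perm (Fin d)) :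
    ∃ u, Sorted π τ u ∧ (∀ c, facetHom π τ c u ≠ 0) ∧
      ∀ π' τ', Sorted π' τ' u → π' = π ∧ τ' = τ := by
  set u : Fin (d + 1) → ℝ := ∑ j, ((τ j : ℝ) + 1) • step π j with hu
  have hdiff : ∀ j, firstDiff π u j = (τ j : ℝ) + 1 := fun j => by
    rw [hu, firstDiff_sum_smul_step]
  have hpos : ∀ c, 0 < facetHom π τ c u := by
    rintro (j | ⟨⟨p, q⟩, hpq⟩)
    · change 0 < firstDiff π u j
      rw [hdiff]
      positivity
    · change 0 < firstDiff π u (τ.symm q) - firstDiff π u (τ.symm p)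
      rw [hdiff, hdiff]
      have : ((p : ℕ) : ℝ) < (q : ℕ) := Nat.cast_lt.mpr hpq
      simpa using this
  refine ⟨u, sorted_iff_facetHom.mpr fun c => (hpos c).le, fun c => (hpos c).ne', ?_⟩
  intro π' τ' h
  have h1 : StrictMono fun i => u (π.symm i) :=
    Fin.strictMono_iff_lt_succ.mpr fun j => sub_pos.mp (hpos (.inl j))
  obtain rfl := eq_of_strictMono_of_monotone h1 h.1
  refine ⟨rfl, eq_of_strictMono_of_monotone (g := firstDiff π' u) (fun p q hpq => ?_) h.2⟩
  exact sub_pos.mp (hpos (.inr ⟨(p, q), hpq⟩))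

theorem IsPolyhedron.isClosed {n : ℕ} {P : Set (Fin n → ℝ)} (h : IsPolyhedron P) :
    IsClosed P := by
  obtain ⟨m, a, c, rfl⟩ := h
  rw [Set.ofPred_forall]
  exact isClosed_iInter fun i =>
    isClosed_le (continuous_const.dotProduct continuous_id) continuous_const

theorem IsGeneralizedNestedPermutohedron.supportLinear {P : Set (Fin (d + 1) → ℝ)}
    (h : IsGeneralizedNestedPermutohedron P) : SupportLinear P := by
  obtain ⟨hne, ⟨hP, hbdd⟩, ⟨N, hN⟩, hco⟩ := h
  intro π τ
  obtain ⟨u, hu, hgen, huniq⟩ := exists_generic π τ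
  let F : Set (Fin (d + 1) → ℝ) := {x | x ∈ P ∧ ∀ y ∈ P, u ⬝ᵥ y ≤ u ⬝ᵥ x}
  have hFP : F ⊆ P := fun x hx => hx.1
  obtain ⟨x, hx, hmax⟩ := (Metric.isCompact_of_isClosed_isBounded hP.isClosed hbdd).exists_isMaxOn
    hne (f := fun x => u ⬝ᵥ x) (continuous_const.dotProduct continuous_id).continuousOn
  have hxF : x ∈ F := ⟨hx, fun y hy => hmax hy⟩
  let φ : (Fin (d + 1) → ℝ) →ₗ[ℝ] ℝ :=
    { toFun := fun x => u ⬝ᵥ x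
      map_add' := dotProduct_add u
      map_smul' := fun c x => dotProduct_smul c u x }
  obtain ⟨A, hA, hC⟩ := hco _ ⟨F, ⟨⟨x, hxF⟩, φ, rfl⟩, rfl⟩
  have huC : toW d u ∈ ncone F P := (toW_mem_ncone hN hFP).mpr fun x hx y hy => hx.2 y hy
  rw [hC] at huC
  obtain ⟨G, hGA, huG⟩ := huC
  obtain ⟨π', τ', -, ψ, rfl⟩ := hA hGA
  obtain ⟨rfl, rfl⟩ := huniq π' τ' (toW_mem_nestedCone.mp huG.1)
  refine ⟨x, hx, fun s hs => ?_⟩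
  -- The functional `ψ` attains its maximum over the cone at an interior point, so it vanishes.
  have hsG : toW d s ∈ ncone F P := by
    rw [hC]
    refine ⟨_, hGA, toW_mem_nestedCone.mpr hs, fun y hy => (huG.2 y hy).trans ?_⟩
    obtain ⟨δ, hδ, hsub⟩ := hu.exists_sub_smul (s := s) fun c hc => absurd hc (hgen c)
    have h1 := huG.2 _ (toW_mem_nestedCone.mpr hsub)
    have h2 := huG.2 (toW d ((2 : ℝ) • u)) (toW_mem_nestedCone.mpr (sorted_iff_facetHom.mpr
      fun c => by
        rw [map_smul]
        exact smul_nonneg zero_le_two (sorted_iff_facetHom.mp hu c)))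
    simp only [map_sub, map_smul, smul_eq_mul] at h1 h2
    have h3 : 0 ≤ ψ (toW d s) := nonneg_of_mul_nonneg_right (by linarith) hδ
    linarith
  exact (toW_mem_ncone hN hFP).mp hsG x hxF

/-! ### The support numbers of a generalized nested permutohedron -/

/-- The number `b T` is the maximum of `⟨e_T, x⟩` over `P`, for all `T`. -/
def IsSupportNumbers (P : Set (Fin (d + 1) → ℝ)) (b : OrderedPartition d → ℝ) : Prop :=
  ∀ T, (∀ x ∈ P, T.e ⬝ᵥ x ≤ b T) ∧ ∃ x ∈ P, T.e ⬝ᵥ x = b T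

theorem IsSupportNumbers.unique {P : Set (Fin (d + 1) → ℝ)} {b b' : OrderedPartition d → ℝ}
    (h : IsSupportNumbers P b) (h' : IsSupportNumbers P b') : b = b' := by
  funext T
  obtain ⟨h1, x, hx, hxe⟩ := h T
  obtain ⟨h1', x', hx', hxe'⟩ := h' T
  exact le_antisymm (hxe ▸ h1' x hx) (hxe' ▸ h1 x' hx')

theorem SupportLinear.exists_isSupportNumbers {P : Set (Fin (d + 1) → ℝ)} (h : SupportLinear P) :
    ∃ b, IsSupportNumbers P b := by
  choose v hv hle using h.exists_forall_dotProduct_le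
  exact ⟨fun T => T.e ⬝ᵥ v T.e, fun T => ⟨hle _, v T.e, hv _, rfl⟩⟩

theorem exists_upperSep_eq (A : Finset (Fin d)) : ∃ τ k, upperSep τ k = A := by
  obtain ⟨τ, hτ⟩ := exists_monotone_comp_symm fun j => if j ∈ A then (1 : ℝ) else 0
  rcases A.eq_empty_or_nonempty with rfl | hA
  · exact ⟨τ, d, upperSep_eq_empty τ le_rfl⟩
  · obtain ⟨j, hj, hmin⟩ := A.exists_min_image (fun j => τ j) hA
    refine ⟨τ, τ j, ?_⟩
    ext l
    rw [mem_upperSep]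
    refine ⟨fun hl => ?_, fun hl => hmin l hl⟩
    by_contra hlA
    have := hτ (show τ j ≤ τ l from hl)
    simp only [Equiv.symm_apply_apply, hj, hlA, if_true, if_false] at this
    linarith

theorem isSupportNumbers_solutionSet {b : OrderedPartition d → ℝ} (hb : LocallySubmodular b)
    (hren : RenCondition b) : IsSupportNumbers (solutionSet b) b := fun T => by
  refine ⟨fun x hx => e_dotProduct_le_of_mem hx T, ?_⟩
  obtain ⟨π, A, rfl⟩ := T.exists_eq_part
  obtain ⟨τ, k, rfl⟩ := exists_upperSep_eq A
  obtain ⟨v, hv⟩ := exists_isVertexAt b π τ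
  exact ⟨v, hv.mem_solutionSet hb hren, hv k⟩

theorem firstDiff_e_part (π : Equiv.Perm (Fin (d + 1))) (A : Finset (Fin d)) (j : Fin d) :
    firstDiff π (part π A).e j = if j ∈ A then 1 else 0 := by
  simp only [firstDiff, e_apply, lvl_part, Equiv.apply_symm_apply, sepCount_succ]
  split_ifs <;> simp

theorem sorted_e_part_iff {A : Finset (Fin d)} : Sorted π τ (part π A).e ↔
    Monotone fun i => if τ.symm i ∈ A then (1 : ℝ) else 0 := by
  simp only [Sorted, firstDiff_e_part, and_iff_right_iff_imp]
  refine fun _ => monotone_of_firstDiff_nonneg fun j => ?_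
  rw [firstDiff_e_part]
  split_ifs <;> simp

theorem exists_sorted_e_part_of_subset (π : Equiv.Perm (Fin (d + 1))) {A B : Finset (Fin d)}
    (h : A ⊆ B) : ∃ τ, Sorted π τ (part π A).e ∧ Sorted π τ (part π B).e := by
  obtain ⟨τ, hτ⟩ := exists_monotone_comp_symm fun j =>
    (if j ∈ A then (1 : ℝ) else 0) + if j ∈ B then 1 else 0
  refine ⟨τ, sorted_e_part_iff.mpr fun p q hpq => ?_, sorted_e_part_iff.mpr fun p q hpq => ?_⟩ <;>
  · have h1 := hτ hpq
    have h2 := @h (τ.symm p)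
    have h3 := @h (τ.symm q)
    simp only at h1 ⊢
    split_ifs at h1 ⊢ <;> first | linarith | simp_all

namespace IsSupportNumbers

variable {P : Set (Fin (d + 1) → ℝ)}

/-- Two comparable elements attain their support numbers at a common point of `P`. -/
theorem exists_common (h : IsSupportNumbers P b) (hP : SupportLinear P)
    (π : Equiv.Perm (Fin (d + 1))) {A B : Finset (Fin d)} (hAB : A ⊆ B) :
    ∃ v ∈ P, (part π A).e ⬝ᵥ v = b (part π A) ∧ (part π B).e ⬝ᵥ v = b (part π B) := by
  obtain ⟨τ, hA, hB⟩ := exists_sorted_e_part_of_subset π hAB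
  obtain ⟨v, hv, hle⟩ := hP π τ
  have key : ∀ T : OrderedPartition d, Sorted π τ T.e → T.e ⬝ᵥ v = b T := fun T hT => by
    obtain ⟨h1, x, hx, hxe⟩ := h T
    exact le_antisymm (h1 v hv) (hxe ▸ hle _ hT x hx)
  exact ⟨v, hv, key _ hA, key _ hB⟩

theorem locallySubmodular (h : IsSupportNumbers P b) (hP : SupportLinear P) :
    LocallySubmodular b := locallySubmodular_iff.mpr fun π A B => by
  obtain ⟨v, hv, h1, h2⟩ := h.exists_common hP π
    (inter_subset_left.trans subset_union_left : A ∩ B ⊆ A ∪ B)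
  have := congrArg (· ⬝ᵥ v) (e_part_inter_add_union π A B)
  simp only [add_dotProduct, h1, h2] at this
  rw [this]
  exact add_le_add ((h _).1 v hv) ((h _).1 v hv)

theorem renCondition (h : IsSupportNumbers P b) (hP : SupportLinear P) {N : ℝ}
    (hN : ∀ x ∈ P, 1 ⬝ᵥ x = N) : RenCondition b := renCondition_iff.mpr fun π i => by
  obtain ⟨v, hv, h1, h2⟩ := h.exists_common hP π (neighbors_subset i)
  have htop : b ⊤ = 1 ⬝ᵥ v := by
    obtain ⟨-, x, hx, hxe⟩ := h ⊤
    rw [← hxe, e_top, hN x hx, hN v hv]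
  have := congrArg (· ⬝ᵥ v) (e_ofPerm_add_e_ofPerm_swapAt π i)
  simp only [add_dotProduct, smul_dotProduct, h1, h2] at this
  rw [nsmul_eq_mul, Nat.cast_ofNat] at this
  rw [← this, htop]
  refine add_le_add (add_le_add ((h _).1 v hv) ((h _).1 v hv)) (le_of_eq ?_)
  split_ifs <;> simp

theorem eq_solutionSet (h : IsSupportNumbers P b) (hP : SupportLinear P) (hpoly : IsPolyhedron P)
    {N : ℝ} (hN : ∀ x ∈ P, 1 ⬝ᵥ x = N) : P = solutionSet b := by
  have htop : b ⊤ = N := by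
    obtain ⟨-, x, hx, hxe⟩ := h ⊤
    rw [← hxe, e_top, hN x hx]
  refine Set.Subset.antisymm (fun x hx => ⟨(hN x hx).trans htop.symm, fun T _ => (h T).1 x hx⟩) ?_
  intro x hx
  obtain ⟨m, a, c, rfl⟩ := hpoly
  intro i
  obtain ⟨π, τ, hs⟩ := exists_sorted (a i)
  obtain ⟨v, hv, hle⟩ := hP π τ
  refine le_trans ?_ (hv i)
  refine dotProduct_le_dotProduct hs.2 (by rw [hx.1, htop, hN v hv]) (fun k => ?_)
    (Or.inl (firstDiff_nonneg hs.1))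
  have hsk : Sorted π τ (part π (upperSep τ k)).e := sorted_e_part_iff.mpr fun p q hpq => by
    have : k ≤ (p : ℕ) → k ≤ (q : ℕ) := fun h => h.trans hpq
    simp only [mem_upperSep, Equiv.apply_symm_apply]
    split_ifs <;> simp_all
  obtain ⟨-, y, hy, hye⟩ := h (part π (upperSep τ k))
  exact ((e_dotProduct_le_of_mem hx _).trans hye.ge).trans (hle _ hsk y hy)

end IsSupportNumbers

theorem isGeneralizedNestedPermutohedron_solutionSet {b : OrderedPartition d → ℝ}
    (hb : LocallySubmodular b) (hren : RenCondition b) :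
    IsGeneralizedNestedPermutohedron (solutionSet b) :=
  (supportLinear_solutionSet hb hren).isGeneralizedNestedPermutohedron
    (isPolyhedron_solutionSet b) fun _ hx => hx.1

end NestedBraid

theorem theorem4p17 (d : ℕ) :
    (∀ b : NestedBraid.OrderedPartition d → ℝ,
      NestedBraid.LocallySubmodular b → NestedBraid.RenCondition b →
        NestedBraid.IsGeneralizedNestedPermutohedron (NestedBraid.solutionSet b)) ∧
    (∀ P : Set (Fin (d + 1) → ℝ), NestedBraid.IsGeneralizedNestedPermutohedron P →
      ∃! b : NestedBraid.OrderedPartition d → ℝ,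
        NestedBraid.LocallySubmodular b ∧ NestedBraid.RenCondition b ∧
          P = NestedBraid.solutionSet b) ∧
    (∀ (P : Set (Fin (d + 1) → ℝ)) (b : NestedBraid.OrderedPartition d → ℝ),
      NestedBraid.IsPolytope P → P = NestedBraid.solutionSet b → NestedBraid.IsTight b →
        (NestedBraid.IsGeneralizedNestedPermutohedron P ↔
          NestedBraid.LocallySubmodular b ∧ NestedBraid.RenCondition b)) := by
  refine ⟨fun b hb hren => NestedBraid.isGeneralizedNestedPermutohedron_solutionSet hb hren,
    fun P hP => ?_, ?_⟩
  · have hlin := hP.supportLinear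
    obtain ⟨-, ⟨hpoly, -⟩, ⟨N, hN⟩, -⟩ := hP
    obtain ⟨b, hb⟩ := hlin.exists_isSupportNumbers
    refine ⟨b, ⟨hb.locallySubmodular hlin, hb.renCondition hlin hN,
      hb.eq_solutionSet hlin hpoly hN⟩, ?_⟩
    rintro b' ⟨h1, h2, rfl⟩
    exact (NestedBraid.isSupportNumbers_solutionSet h1 h2).unique hb
  · rintro P b - rfl htight
    refine ⟨fun hP => ?_, fun h =>
      NestedBraid.isGeneralizedNestedPermutohedron_solutionSet h.1 h.2⟩
    have hb : NestedBraid.IsSupportNumbers (NestedBraid.solutionSet b) b := fun T => by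
      refine ⟨fun x hx => NestedBraid.e_dotProduct_le_of_mem hx T, ?_⟩
      by_cases hT : T = ⊤
      · obtain ⟨x, hx⟩ := hP.1
        exact ⟨x, hx, by rw [hT, NestedBraid.e_top, hx.1]⟩
      · exact htight T hT
    exact ⟨hb.locallySubmodular hP.supportLinear,
      hb.renCondition hP.supportLinear fun _ hx => hx.1⟩
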